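/- Fix a period $L>0$ and write $\mathbb T_L=\mathbb R/L\mathbb Z$, $\langle x\rangle=1+|x|$, $\gamma_L(n)=(2\pi/L)^2\sqrt{n^2+n^4}$. For $u:\mathbb T_L\times\mathbb R\to\mathbb C$ let $$\widetilde u(n,\tau)=\frac1L\int_{\mathbb R}\int_0^L u(x,t)\,e^{-2\pi i n x/L}\,e^{-it\tau}\,dx\,dt ,\qquad n\in\mathbb Z,\ \tau\in\mathbb R,$$ be its space-time Fourier transform (understood in the sense of tempered distributions). For $s,b\in\mathbb R$ let $X^S_{s,b}$ and $X^B_{s,b}$ be the completions, with respect to the norms $$\|u\|_{X^S_{s,b}}=\big\|\langle \tau+(2\pi n/L)^2\rangle^b\langle n\rangle^s\,\widetilde u(n,\tau)\big\|_{\ell^2_nL^2_\tau},\qquad \|u\|_{X^B_{s,b}}=\big\|\langle |\tau|-\gamma_L(n)\rangle^b\langle n\rangle^s\,\widetilde u(n,\tau)\big\|_{\ell^2_nL^2_\tau},$$ of the space of functions on $\mathbb T_L\times\mathbb R$ that are $C^\infty$ in $x$ for each $t$ and Schwartz in $t$ for each $x$ (and for which the norm is finite). **Theorem.** Let $a,a_1,b,b_1>1/4$.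 Then there exists $c>0$, depending only on $a,a_1,b,b_1$ (and on the fixed period $L$), such that (i) for all $u\in X^S_{0,b_1}$ and $v\in X^B_{0,b}$ the product $uv$ belongs to $X^S_{0,-a_1}$ and $$\|uv\|_{X^S_{0,-a_1}}\le c\,\|u\|_{X^S_{0,b_1}}\|v\|_{X^B_{0,b}};$$ (ii) for all $u_1,u_2\in X^S_{0,b_1}$ the product $u_1\bar u_2$ belongs to $X^B_{0,-a}$ and $$\|u_1\bar u_2\|_{X^B_{0,-a}}\le c\,\|u_1\|_{X^S_{0,b_1}}\|u_2\|_{X^S_{0,b_1}} .$$ -/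

import Mathlib

open MeasureTheory Filter
open scoped ENNReal Topology SchwartzMap ComplexConjugate

noncomputable section

namespace SB

/-- The bracket `⟨a⟩ = 1 + |a|`. -/
def bracket (a : ℝ) : ℝ := 1 + |a|

/-- The measure `(1/L) dx ⊗ dt` on `(ℝ / Lℤ) × ℝ` (`haarAddCircle` is `(1/L) dx` on the circle). -/
def stMeasure (L : ℝ) [Fact (0 < L)] : Measure (AddCircle L × ℝ) :=
  (AddCircle.haarAddCircle (T := L)).prod volume

/-- `U n τ` is the space-time Fourier transform
`(1/L) ∫_ℝ ∫_0^L u (x, t) e^{-2π i n x / L} e^{-i t τ} dx dt` of `u`, in the usual sense of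
tempered distributions in the time variable: `u` and every `U n` are integrable against Schwartz
functions of time (resp. of `τ`), and for every `n` and every Schwartz function `φ` the function
`(1/L) ∫_0^L u (x, ·) e^{-2π i n x / L} dx` tested against the Fourier transform of `φ` is `U n`
tested against `φ`. Such a `U` is unique up to null sets of `τ`, for each `n`. -/
structure IsSpaceTimeFourier (L : ℝ) [Fact (0 < L)] (u : AddCircle L × ℝ → ℂ)
    (U : ℤ → ℝ → ℂ) : Prop where
  integrable_left : ∀ φ : 𝓢(ℝ, ℂ), Integrable (fun p => u p * φ p.2) (stMeasure L)
  integrable_right : ∀ (n : ℤ) (φ : 𝓢(ℝ, ℂ)), Integrable (fun τ => U n τ * φ τ) volume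
  integral_eq : ∀ (n : ℤ) (φ : 𝓢(ℝ, ℂ)),
    ∫ p, u p * fourier (-n) p.1 *
        (∫ τ : ℝ, Complex.exp (-(Complex.I * (p.2 : ℂ) * (τ : ℂ))) * φ τ) ∂(stMeasure L)
      = ∫ τ : ℝ, U n τ * φ τ

/-- The norm of `l²_n L²_τ`. -/
def l2L2Norm (U : ℤ → ℝ → ℂ) : ℝ≥0∞ :=
  (∑' n : ℤ, (eLpNorm (U n) 2 volume) ^ 2) ^ (1 / 2 : ℝ)

/-- The weighted Fourier norm `‖w(n, τ) ũ(n, τ)‖_{l²_n L²_τ}` of a function `u` on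
`(ℝ / Lℤ) × ℝ`. Since `ũ` is unique up to null sets, the infimum is over a family with a single
value; it is `∞` if `u` has no space-time Fourier transform that is a function. -/
def weightedNorm (L : ℝ) [Fact (0 < L)] (w : ℤ → ℝ → ℝ) (u : AddCircle L × ℝ → ℂ) : ℝ≥0∞ :=
  ⨅ (U : ℤ → ℝ → ℂ) (_ : IsSpaceTimeFourier L u U),
    l2L2Norm (fun n τ => (w n τ : ℂ) * U n τ)

/-- The class `𝒴`: functions on `(ℝ / Lℤ) × ℝ` that are Schwartz in time for each `x` and smooth
(and `L`-periodic) in space for each `t`. -/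
def testClass (L : ℝ) : Set (AddCircle L × ℝ → ℂ) :=
  {F | (∀ x : AddCircle L, ∃ f : 𝓢(ℝ, ℂ), ∀ t : ℝ, F (x, t) = f t) ∧
    ∀ t : ℝ, ContDiff ℝ (⊤ : ℕ∞) (fun x : ℝ => F ((x : AddCircle L), t))}

/-- `u` belongs to the completion of `𝒴` with respect to the norm with weight `w`: it has finite
norm and is a limit, in that norm, of elements of `𝒴`. -/
def MemCompletion (L : ℝ) [Fact (0 < L)] (w : ℤ → ℝ → ℝ) (u : AddCircle L × ℝ → ℂ) : Prop :=
  weightedNorm L w u < ⊤ ∧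
    ∃ F : ℕ → AddCircle L × ℝ → ℂ, (∀ k, F k ∈ testClass L) ∧
      Tendsto (fun k => weightedNorm L w (F k - u)) atTop (𝓝 0)

/-- The Schrödinger weight `⟨τ + (2πn/L)²⟩^b ⟨n⟩^s`. -/
def weightS (L s b : ℝ) (n : ℤ) (τ : ℝ) : ℝ :=
  bracket (τ + (2 * Real.pi * n / L) ^ 2) ^ b * bracket (n : ℝ) ^ s

/-- The Boussinesq symbol `γ_L(n) = (2π/L)² √(n² + n⁴)`. -/
def gammaL (L : ℝ) (n : ℤ) : ℝ :=
  (2 * Real.pi / L) ^ 2 * Real.sqrt ((n : ℝ) ^ 2 + (n : ℝ) ^ 4)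

/-- The Boussinesq weight `⟨|τ| - γ_L(n)⟩^b ⟨n⟩^s`. -/
def weightB (L s b : ℝ) (n : ℤ) (τ : ℝ) : ℝ :=
  bracket (|τ| - gammaL L n) ^ b * bracket (n : ℝ) ^ s

/-- The norm of `X^S_{s,b}`. -/
def normXS (L : ℝ) [Fact (0 < L)] (s b : ℝ) (u : AddCircle L × ℝ → ℂ) : ℝ≥0∞ :=
  weightedNorm L (weightS L s b) u

/-- The norm of `X^B_{s,b}`. -/
def normXB (L : ℝ) [Fact (0 < L)] (s b : ℝ) (u : AddCircle L × ℝ → ℂ) : ℝ≥0∞ :=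
  weightedNorm L (weightB L s b) u

/-- The function `u` belongs to `X^S_{s,b}`. -/
def MemXS (L : ℝ) [Fact (0 < L)] (s b : ℝ) (u : AddCircle L × ℝ → ℂ) : Prop :=
  MemCompletion L (weightS L s b) u

/-- The function `u` belongs to `X^B_{s,b}`. -/
def MemXB (L : ℝ) [Fact (0 < L)] (s b : ℝ) (u : AddCircle L × ℝ → ℂ) : Prop :=
  MemCompletion L (weightB L s b) u

end SB

end

/-! On the Fourier side both estimates bound one trilinear form, the sum over n, m and integral over
τ, s of h(n, τ) f(m, s) g(m - n, s - τ) against negative powers of three modulations: two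
Schrödinger, one Boussinesq. Part (i) fits this form because u v = u · conj(conj v) and conjugation
does not increase the Boussinesq norm (`weightedNorm_conj_le`).

The gain comes from `resonance`. Put κ = (2π/L)². Since γ_L(k) = κk² + O(κ), a combination of the
modulations at frequencies p, q, p - q with coefficients ±1 equals 2κp(p - q) or 2κq(p - q) up to
O(κ), according to the sign of the Boussinesq time frequency. So the square of the smallest
frequency bracket is at most a constant times the largest modulation.

Let d > 1/4 be the smallest exponent. The largest modulation to the power -d is traded for a
frequency bracket to the power -2d, and the other two for a sum of single modulations to the power
-2d (`weight_prod_le`). Every factor left is square integrable or square summable because 4d > 1, so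
Cauchy-Schwarz in time and then in frequency closes the estimate (`lintegral_young`,
`seqNormL2_weighted_corr_le`).

To return to physical space, positive exponents put u and v in L², so u · conj v is integrable. Its
transform at (n, τ) is the pairing of u with a modulated v, and Plancherel bounds it by the
correlation of |U| and |V| (`IsSpaceTimeFourier.exists_mul_conj`). Membership in the completions
follows since the products preserve the test class and are bounded bilinear over the reals
(`MemCompletion.map₂`). -/

namespace SB

/-! ### L² duality and Young-type trilinear inequalities -/

section Young

set_option linter.unusedSectionVars false

variable {G : Type*} [MeasurableSpace G]

/-- The `L²` norm of a function with values in `[0, ∞]`. -/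
noncomputable def normL2 (μ : Measure G) (f : G → ℝ≥0∞) : ℝ≥0∞ :=
  (∫⁻ x, f x ^ 2 ∂μ) ^ (1 / 2 : ℝ)

theorem normL2_sq (μ : Measure G) (f : G → ℝ≥0∞) : normL2 μ f ^ 2 = ∫⁻ x, f x ^ 2 ∂μ := by
  rw [normL2, ← ENNReal.rpow_natCast, ← ENNReal.rpow_mul]
  norm_num

theorem normL2_mono {μ : Measure G} {f g : G → ℝ≥0∞} (h : ∀ x, f x ≤ g x) :
    normL2 μ f ≤ normL2 μ g := by
  unfold normL2
  gcongr with x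
  exact h x

theorem normL2_const_mul {μ : Measure G} (c : ℝ≥0∞) {f : G → ℝ≥0∞} (hf : Measurable f) :
    normL2 μ (fun x => c * f x) = c * normL2 μ f := by
  unfold normL2
  simp_rw [mul_pow]
  rw [lintegral_const_mul _ (hf.pow_const 2), ENNReal.mul_rpow_of_nonneg _ _ (by norm_num),
    ← ENNReal.rpow_natCast c, ← ENNReal.rpow_mul]
  norm_num

theorem lintegral_mul_le_normL2 (μ : Measure G) {f g : G → ℝ≥0∞} (hf : Measurable f)
    (hg : Measurable g) : ∫⁻ x, f x * g x ∂μ ≤ normL2 μ f * normL2 μ g := by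
  have := ENNReal.lintegral_mul_le_Lp_mul_Lq μ Real.HolderConjugate.two_two hf.aemeasurable
    hg.aemeasurable
  simpa [normL2] using this

/-- A function is bounded in `L²` as soon as its pairings with `L²` functions are. -/
theorem normL2_le_of_forall {μ : Measure G} [SigmaFinite μ] {K : G → ℝ≥0∞} {C : ℝ≥0∞}
    (h : ∀ f : G → ℝ≥0∞, Measurable f → ∫⁻ x, K x * f x ∂μ ≤ C * normL2 μ f) :
    normL2 μ K ≤ C := by
  by_contra! hlt
  have hlt2 : C ^ 2 < ∫⁻ x, K x ^ 2 ∂μ := by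
    rw [← normL2_sq]
    exact ENNReal.pow_lt_pow_left two_ne_zero hlt
  -- `K` need not be measurable nor have finite norm, so it cannot be its own test function. A
  -- simple `g ≤ K²` with finite integral above `C²` replaces `K²`, and the pairing is tested
  -- against `√g`.
  simp_rw [lintegral_eq_nnreal, lt_iSup_iff] at hlt2
  obtain ⟨g₀, hg₀, hg₀C⟩ := hlt2
  rw [← SimpleFunc.lintegral_eq_lintegral, SimpleFunc.coe_map] at hg₀C
  obtain ⟨g, hg, hgtop, hgC⟩ := SimpleFunc.exists_lt_lintegral_simpleFunc_of_lt_lintegral hg₀C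
  have hgK (x : G) : (g x : ℝ≥0∞) ≤ K x ^ 2 := (ENNReal.coe_le_coe.2 (hg x)).trans (hg₀ x)
  set I := ∫⁻ x, (g x : ℝ≥0∞) ∂μ with hI
  have hroot (c : ℝ≥0∞) : c ^ (1 / 2 : ℝ) * c ^ (1 / 2 : ℝ) = c := by
    rw [← ENNReal.rpow_add_of_nonneg _ _ (by norm_num) (by norm_num)]
    norm_num
  have key := h (fun x => (g x : ℝ≥0∞) ^ (1 / 2 : ℝ))
    ((g.measurable.coe_nnreal_ennreal).pow_const _)
  have hle : I ≤ C * I ^ (1 / 2 : ℝ) := by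
    refine le_trans ?_ (key.trans_eq ?_)
    · rw [hI]
      gcongr with x
      calc (g x : ℝ≥0∞) = (g x : ℝ≥0∞) ^ (1 / 2 : ℝ) * (g x : ℝ≥0∞) ^ (1 / 2 : ℝ) :=
            (hroot _).symm
        _ ≤ (K x ^ 2) ^ (1 / 2 : ℝ) * (g x : ℝ≥0∞) ^ (1 / 2 : ℝ) := by
            gcongr
            exact hgK x
        _ = K x * (g x : ℝ≥0∞) ^ (1 / 2 : ℝ) := by
            rw [← ENNReal.rpow_natCast, ← ENNReal.rpow_mul]
            norm_num
    · simp_rw [normL2, sq, hroot, hI]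
  have hI0 : I ≠ 0 := (pos_of_gt hgC).ne'
  have hIr : I ^ (1 / 2 : ℝ) ≤ C := by
    nth_rewrite 1 [← hroot I] at hle
    refine (ENNReal.mul_le_mul_iff_left ?_ ?_).1 hle
    · simp [hI0]
    · exact ENNReal.rpow_ne_top_of_nonneg (by norm_num) hgtop.ne
  have : I ≤ C ^ 2 := by
    rw [← hroot I, sq]
    gcongr
  exact absurd hgC this.not_gt

variable [AddCommGroup G] [MeasurableAdd₂ G] [MeasurableNeg G] (μ : Measure G) [SFinite μ]
  [μ.IsAddLeftInvariant] [μ.IsNegInvariant]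

theorem normL2_comp_sub_left (h : G → ℝ≥0∞) (y : G) :
    normL2 μ (fun x => h (y - x)) = normL2 μ h := by
  unfold normL2
  rw [lintegral_sub_left_eq_self (fun x => h x ^ 2) y]

theorem normL2_comp_sub_right (h : G → ℝ≥0∞) (y : G) :
    normL2 μ (fun x => h (x - y)) = normL2 μ h := by
  unfold normL2
  rw [lintegral_sub_right_eq_self (fun x => h x ^ 2) y]

/-- Cauchy-Schwarz in `y`, with translation invariance of the norm of `h`, then Cauchy-Schwarz in
`x` for `a` against `f`. The two variants below freeze `y`, respectively `y - x`, instead of `x`. -/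
theorem lintegral_young_left {a f g h : G → ℝ≥0∞} (ha : Measurable a) (hf : Measurable f)
    (hg : Measurable g) (hh : Measurable h) :
    ∫⁻ x, ∫⁻ y, a x * (f x * (g y * h (y - x))) ∂μ ∂μ
      ≤ normL2 μ a * (normL2 μ f * (normL2 μ g * normL2 μ h)) := by
  calc ∫⁻ x, ∫⁻ y, a x * (f x * (g y * h (y - x))) ∂μ ∂μ
      ≤ ∫⁻ x, a x * f x * (normL2 μ g * normL2 μ h) ∂μ := by
        gcongr with x
        have hm : Measurable fun y => h (y - x) := hh.comp (measurable_id.sub_const x)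
        rw [lintegral_const_mul _ (by fun_prop), lintegral_const_mul _ (by fun_prop), mul_assoc]
        gcongr
        rw [← normL2_comp_sub_right μ h x]
        exact lintegral_mul_le_normL2 μ hg hm
    _ = (∫⁻ x, a x * f x ∂μ) * (normL2 μ g * normL2 μ h) :=
        lintegral_mul_const _ (by fun_prop)
    _ ≤ normL2 μ a * normL2 μ f * (normL2 μ g * normL2 μ h) := by
        gcongr
        exact lintegral_mul_le_normL2 μ ha hf
    _ = _ := mul_assoc _ _ _

theorem lintegral_young_mid {a f g h : G → ℝ≥0∞} (ha : Measurable a) (hf : Measurable f)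
    (hg : Measurable g) (hh : Measurable h) :
    ∫⁻ x, ∫⁻ y, a y * (f x * (g y * h (y - x))) ∂μ ∂μ
      ≤ normL2 μ a * (normL2 μ f * (normL2 μ g * normL2 μ h)) := by
  rw [lintegral_lintegral_swap (by fun_prop)]
  calc ∫⁻ y, ∫⁻ x, a y * (f x * (g y * h (y - x))) ∂μ ∂μ
      = ∫⁻ y, ∫⁻ x, a y * (g y * (f x * h (y - x))) ∂μ ∂μ := by
        congr! 4; ring
    _ ≤ ∫⁻ x, a x * g x * (normL2 μ f * normL2 μ h) ∂μ := by
        gcongr with x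
        have hm : Measurable fun y => h (x - y) := hh.comp (measurable_id.const_sub x)
        rw [lintegral_const_mul _ (by fun_prop), lintegral_const_mul _ (by fun_prop), mul_assoc]
        gcongr
        rw [← normL2_comp_sub_left μ h x]
        exact lintegral_mul_le_normL2 μ hf hm
    _ = (∫⁻ x, a x * g x ∂μ) * (normL2 μ f * normL2 μ h) :=
        lintegral_mul_const _ (by fun_prop)
    _ ≤ normL2 μ a * normL2 μ g * (normL2 μ f * normL2 μ h) := by
        gcongr
        exact lintegral_mul_le_normL2 μ ha hg
    _ = _ := by ring

theorem lintegral_young_right {a f g h : G → ℝ≥0∞} (ha : Measurable a) (hf : Measurable f)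
    (hg : Measurable g) (hh : Measurable h) :
    ∫⁻ x, ∫⁻ y, a (y - x) * (f x * (g y * h (y - x))) ∂μ ∂μ
      ≤ normL2 μ a * (normL2 μ f * (normL2 μ g * normL2 μ h)) := by
  have hm (x : G) : normL2 μ (fun y => g (y + x)) = normL2 μ g := by
    unfold normL2
    rw [lintegral_add_right_eq_self (fun y => g y ^ 2) x]
  calc ∫⁻ x, ∫⁻ y, a (y - x) * (f x * (g y * h (y - x))) ∂μ ∂μ
      = ∫⁻ x, ∫⁻ y, a y * (f x * (g (y + x) * h y)) ∂μ ∂μ := by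
        congr! 2 with x
        rw [← lintegral_add_right_eq_self _ x]
        simp
    _ = ∫⁻ y, ∫⁻ x, a y * (f x * (g (y + x) * h y)) ∂μ ∂μ :=
        lintegral_lintegral_swap (by fun_prop)
    _ = ∫⁻ y, ∫⁻ x, a y * (h y * (f x * g (x + y))) ∂μ ∂μ := by
        congr! 4 with y x; rw [add_comm y x]; ring
    _ ≤ ∫⁻ x, a x * h x * (normL2 μ f * normL2 μ g) ∂μ := by
        gcongr with x
        have hm' : Measurable fun y => g (y + x) := hg.comp (measurable_id.add_const x)
        rw [lintegral_const_mul _ (by fun_prop), lintegral_const_mul _ (by fun_prop), mul_assoc]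
        gcongr
        rw [← hm x]
        exact lintegral_mul_le_normL2 μ hf hm'
    _ = (∫⁻ x, a x * h x ∂μ) * (normL2 μ f * normL2 μ g) :=
        lintegral_mul_const _ (by fun_prop)
    _ ≤ normL2 μ a * normL2 μ h * (normL2 μ f * normL2 μ g) := by
        gcongr
        exact lintegral_mul_le_normL2 μ ha hh
    _ = _ := by ring

/-- The three forms of Young's inequality `L¹ * L² * L² → L¹` with the factor in `L¹` written as
a product of two factors in `L²`. -/
theorem lintegral_young {a b c f g h : G → ℝ≥0∞} (ha : Measurable a) (hb : Measurable b)
    (hc : Measurable c) (hf : Measurable f) (hg : Measurable g) (hh : Measurable h) :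
    ∫⁻ x, ∫⁻ y, (a x + b y + c (y - x)) * (f x * (g y * h (y - x))) ∂μ ∂μ
      ≤ (normL2 μ a + normL2 μ b + normL2 μ c) * (normL2 μ f * (normL2 μ g * normL2 μ h)) := by
  simp_rw [add_mul]
  have e (x : G) : ∫⁻ y, a x * (f x * (g y * h (y - x))) + b y * (f x * (g y * h (y - x)))
        + c (y - x) * (f x * (g y * h (y - x))) ∂μ
      = ∫⁻ y, a x * (f x * (g y * h (y - x))) ∂μ + ∫⁻ y, b y * (f x * (g y * h (y - x))) ∂μ
        + ∫⁻ y, c (y - x) * (f x * (g y * h (y - x))) ∂μ := by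
    rw [lintegral_add_left (by fun_prop), lintegral_add_left (by fun_prop)]
  simp_rw [e]
  rw [lintegral_add_left, lintegral_add_left]
  · gcongr
    · exact lintegral_young_left μ ha hf hg hh
    · exact lintegral_young_mid μ hb hf hg hh
    · exact lintegral_young_right μ hc hf hg hh
  · apply Measurable.lintegral_prod_right'
      (f := fun p : G × G => a p.1 * (f p.1 * (g p.2 * h (p.2 - p.1))))
    fun_prop
  · apply Measurable.add
    · apply Measurable.lintegral_prod_right'
        (f := fun p : G × G => a p.1 * (f p.1 * (g p.2 * h (p.2 - p.1))))
      fun_prop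
    · apply Measurable.lintegral_prod_right'
        (f := fun p : G × G => b p.2 * (f p.1 * (g p.2 * h (p.2 - p.1))))
      fun_prop

end Young
-- Trilinear estimate in `l²L²` for factorised kernels
section Trilinear

/-- The `l²_n L²_τ` norm of a function on `ℤ × ℝ` with values in `[0, ∞]`. -/
noncomputable def seqNormL2 (f : ℤ → ℝ → ℝ≥0∞) : ℝ≥0∞ :=
  normL2 Measure.count fun n => normL2 volume (f n)

theorem seqNormL2_eq (f : ℤ → ℝ → ℝ≥0∞) :
    seqNormL2 f = (∑' n, ∫⁻ τ, f n τ ^ 2) ^ (1 / 2 : ℝ) := by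
  simp_rw [seqNormL2, normL2.eq_1 (Measure.count : Measure ℤ), normL2_sq, lintegral_count]

theorem seqNormL2_sq (f : ℤ → ℝ → ℝ≥0∞) : seqNormL2 f ^ 2 = ∑' n, ∫⁻ τ, f n τ ^ 2 := by
  simp_rw [seqNormL2, normL2_sq, lintegral_count]

theorem seqNormL2_mono {f g : ℤ → ℝ → ℝ≥0∞} (h : ∀ n τ, f n τ ≤ g n τ) :
    seqNormL2 f ≤ seqNormL2 g :=
  normL2_mono fun n => normL2_mono (h n)

theorem measurable_uncurry_int {f : ℤ → ℝ → ℝ≥0∞} (hf : ∀ n, Measurable (f n)) :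
    Measurable (Function.uncurry f) :=
  measurable_from_prod_countable_right hf

theorem seqNormL2_eq_prod {f : ℤ → ℝ → ℝ≥0∞} (hf : ∀ n, Measurable (f n)) :
    seqNormL2 f = normL2 (Measure.count.prod volume) (Function.uncurry f) := by
  rw [seqNormL2_eq, normL2, lintegral_prod _ ((measurable_uncurry_int hf).pow_const 2).aemeasurable,
    lintegral_count]
  rfl

theorem seqNormL2_le_of_forall {K : ℤ → ℝ → ℝ≥0∞} (hK : ∀ n, Measurable (K n)) {C : ℝ≥0∞}
    (h : ∀ f : ℤ → ℝ → ℝ≥0∞, (∀ n, Measurable (f n)) →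
      ∑' n, ∫⁻ τ, K n τ * f n τ ≤ C * seqNormL2 f) :
    seqNormL2 K ≤ C := by
  rw [seqNormL2_eq_prod hK]
  refine normL2_le_of_forall fun f hf => ?_
  have hfn (n : ℤ) : Measurable (Function.curry f n) := hf.comp measurable_prodMk_left
  have := h (Function.curry f) hfn
  rw [seqNormL2_eq_prod hfn, Function.uncurry_curry] at this
  rw [lintegral_prod (fun p => Function.uncurry K p * f p)
    ((measurable_uncurry_int hK).mul hf).aemeasurable, lintegral_count]
  exact this

/-- `∑_m ∫ f(m, s) g(m - n, s - τ) ds`. -/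
noncomputable def seqCorr (f g : ℤ → ℝ → ℝ≥0∞) (n : ℤ) (τ : ℝ) : ℝ≥0∞ :=
  ∑' m, ∫⁻ s, f m s * g (m - n) (s - τ)

theorem measurable_seqCorr {f g : ℤ → ℝ → ℝ≥0∞} (hf : ∀ n, Measurable (f n))
    (hg : ∀ n, Measurable (g n)) (n : ℤ) : Measurable (seqCorr f g n) := by
  refine Measurable.tsum fun m => ?_
  apply Measurable.lintegral_prod_right' (f := fun p : ℝ × ℝ => f m p.2 * g (m - n) (p.2 - p.1))
  have := hf m
  have := hg (m - n)
  fun_prop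

/-- If a product of three weights is at most a product of a sum of functions of the modulations
and a sum of functions of the frequencies, then the associated weighted convolution is bounded
on `l²L²`. -/
theorem seqNormL2_weighted_corr_le {k₀ k₁ k₂ α₀ α₁ α₂ f g : ℤ → ℝ → ℝ≥0∞} {β : ℤ → ℝ≥0∞}
    (hk₀ : ∀ n, Measurable (k₀ n)) (hk₁ : ∀ n, Measurable (k₁ n)) (hk₂ : ∀ n, Measurable (k₂ n))
    (hα₀ : ∀ n, Measurable (α₀ n)) (hα₁ : ∀ n, Measurable (α₁ n)) (hα₂ : ∀ n, Measurable (α₂ n))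
    (hf : ∀ n, Measurable (f n)) (hg : ∀ n, Measurable (g n)) {A : ℝ≥0∞}
    (hA₀ : ∀ n, normL2 volume (α₀ n) ≤ A) (hA₁ : ∀ n, normL2 volume (α₁ n) ≤ A)
    (hA₂ : ∀ n, normL2 volume (α₂ n) ≤ A)
    (hk : ∀ n τ m s, k₀ n τ * (k₁ m s * k₂ (m - n) (s - τ))
      ≤ (α₀ n τ + α₁ m s + α₂ (m - n) (s - τ)) * (β n + β m + β (m - n))) :
    seqNormL2 (fun n τ => k₀ n τ *
        seqCorr (fun m s => k₁ m s * f m s) (fun m s => k₂ m s * g m s) n τ)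
      ≤ (A + A + A) * (normL2 Measure.count β + normL2 Measure.count β + normL2 Measure.count β)
        * (seqNormL2 f * seqNormL2 g) := by
  have hkf (n : ℤ) : Measurable fun s => k₁ n s * f n s := (hk₁ n).mul (hf n)
  have hkg (n : ℤ) : Measurable fun s => k₂ n s * g n s := (hk₂ n).mul (hg n)
  -- By duality it suffices to bound the trilinear form in `h`, `f`, `g`. The kernel bound separates
  -- times from frequencies, so Young applies in time for fixed `n`, `m`, uniformly through `A`, and
  -- then in frequency.
  refine seqNormL2_le_of_forall (fun n => (hk₀ n).mul (measurable_seqCorr hkf hkg n))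
    fun h hh => ?_
  set B := normL2 Measure.count β
  have step1 (n : ℤ) : ∫⁻ τ, k₀ n τ * seqCorr (fun m s => k₁ m s * f m s)
        (fun m s => k₂ m s * g m s) n τ * h n τ
      ≤ ∑' m, (A + A + A) * ((β n + β m + β (m - n)) * (normL2 volume (h n) *
          (normL2 volume (f m) * normL2 volume (g (m - n))))) := by
    calc ∫⁻ τ, k₀ n τ * seqCorr (fun m s => k₁ m s * f m s)
          (fun m s => k₂ m s * g m s) n τ * h n τ
        ≤ ∫⁻ τ, ∑' m, (β n + β m + β (m - n)) *
          ∫⁻ s, (α₀ n τ + α₁ m s + α₂ (m - n) (s - τ)) *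
            (h n τ * (f m s * g (m - n) (s - τ))) := by
          gcongr with τ
          rw [mul_right_comm, seqCorr, ← ENNReal.tsum_mul_left]
          refine ENNReal.tsum_le_tsum fun m => ?_
          have := hα₁ m
          have := hα₂ (m - n)
          have := hf m
          have := hg (m - n)
          have := hk₁ m
          have := hk₂ (m - n)
          rw [← lintegral_const_mul _ (by fun_prop), ← lintegral_const_mul _ (by fun_prop)]
          refine lintegral_mono fun s => ?_
          calc k₀ n τ * h n τ * (k₁ m s * f m s * (k₂ (m - n) (s - τ) * g (m - n) (s - τ)))
              = k₀ n τ * (k₁ m s * k₂ (m - n) (s - τ)) *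
                (h n τ * (f m s * g (m - n) (s - τ))) := by ring
            _ ≤ (α₀ n τ + α₁ m s + α₂ (m - n) (s - τ)) * (β n + β m + β (m - n)) *
                (h n τ * (f m s * g (m - n) (s - τ))) :=
                mul_le_mul' (hk n τ m s) le_rfl
            _ = _ := by ring
      _ = ∑' m, (β n + β m + β (m - n)) *
          ∫⁻ τ, ∫⁻ s, (α₀ n τ + α₁ m s + α₂ (m - n) (s - τ)) *
            (h n τ * (f m s * g (m - n) (s - τ))) := by
          have hm (m : ℤ) : Measurable fun τ => ∫⁻ s, (α₀ n τ + α₁ m s + α₂ (m - n) (s - τ)) *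
              (h n τ * (f m s * g (m - n) (s - τ))) := by
            apply Measurable.lintegral_prod_right' (f := fun p : ℝ × ℝ =>
              (α₀ n p.1 + α₁ m p.2 + α₂ (m - n) (p.2 - p.1)) *
                (h n p.1 * (f m p.2 * g (m - n) (p.2 - p.1))))
            have := hα₀ n
            have := hα₁ m
            have := hα₂ (m - n)
            have := hf m
            have := hg (m - n)
            have := hh n
            fun_prop
          rw [lintegral_tsum fun m => ((hm m).const_mul _).aemeasurable]
          congr! 2 with m
          exact lintegral_const_mul _ (hm m)
      _ ≤ _ := by
          refine ENNReal.tsum_le_tsum fun m => ?_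
          rw [mul_left_comm]
          gcongr
          refine (lintegral_young volume (hα₀ n) (hα₁ m) (hα₂ (m - n)) (hh n) (hf m)
            (hg (m - n))).trans ?_
          gcongr
          · exact hA₀ n
          · exact hA₁ m
          · exact hA₂ (m - n)
  calc ∑' n, ∫⁻ τ, k₀ n τ * seqCorr (fun m s => k₁ m s * f m s)
        (fun m s => k₂ m s * g m s) n τ * h n τ
      ≤ ∑' n, ∑' m, (A + A + A) * ((β n + β m + β (m - n)) * (normL2 volume (h n) *
          (normL2 volume (f m) * normL2 volume (g (m - n))))) :=
        ENNReal.tsum_le_tsum step1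
    _ = (A + A + A) * ∑' n, ∑' m, (β n + β m + β (m - n)) * (normL2 volume (h n) *
          (normL2 volume (f m) * normL2 volume (g (m - n)))) := by
        simp_rw [ENNReal.tsum_mul_left]
    _ ≤ (A + A + A) * ((B + B + B) * (seqNormL2 h * (seqNormL2 f * seqNormL2 g))) := by
        gcongr
        -- The same inequality on `ℤ`, applied to the sequences of time norms.
        have := lintegral_young (G := ℤ) Measure.count (a := β) (b := β) (c := β)
          (f := fun n => normL2 volume (h n)) (g := fun n => normL2 volume (f n))
          (h := fun n => normL2 volume (g n)) .of_discrete .of_discrete .of_discrete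
          .of_discrete .of_discrete .of_discrete
        simp_rw [lintegral_count] at this
        exact this
    _ = _ := by ring

end Trilinear

/-! ### Modulation weights and the resonance relation -/

section Weights

theorem one_le_bracket (a : ℝ) : 1 ≤ bracket a := by
  unfold bracket
  linarith [abs_nonneg a]

theorem bracket_pos (a : ℝ) : 0 < bracket a := zero_lt_one.trans_le (one_le_bracket a)

theorem measurable_bracket : Measurable bracket := by
  unfold bracket
  fun_prop

theorem bracket_rpow_neg_two_mul (a d : ℝ) :
    bracket a ^ (-(2 * d)) = (bracket a ^ (-d)) ^ 2 := by
  rw [← Real.rpow_natCast, ← Real.rpow_mul (bracket_pos a).le]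
  congr 1
  push_cast
  ring

/-- If one of the frequencies is controlled by one of the modulations, a product of negative
powers of modulations is controlled by products of one modulation and one frequency. -/
theorem weight_prod_le {C d e₀ e₁ e₂ : ℝ} (hC : 0 < C) (hd : 0 < d) (he₀ : d ≤ e₀) (he₁ : d ≤ e₁)
    (he₂ : d ≤ e₂) {x₀ x₁ x₂ y₀ y₁ y₂ : ℝ}
    (h : min (bracket y₀) (min (bracket y₁) (bracket y₂)) ^ 2
      ≤ C * max (bracket x₀) (max (bracket x₁) (bracket x₂))) :
    bracket x₀ ^ (-e₀) * (bracket x₁ ^ (-e₁) * bracket x₂ ^ (-e₂))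
      ≤ C ^ d * (bracket x₀ ^ (-(2 * d)) + bracket x₁ ^ (-(2 * d)) + bracket x₂ ^ (-(2 * d)))
        * (bracket y₀ ^ (-(2 * d)) + bracket y₁ ^ (-(2 * d)) + bracket y₂ ^ (-(2 * d))) := by
  have hexp {x e : ℝ} (he : d ≤ e) : bracket x ^ (-e) ≤ bracket x ^ (-d) :=
    Real.rpow_le_rpow_of_exponent_le (one_le_bracket x) (by linarith)
  have hpos (x e : ℝ) : 0 < bracket x ^ e := Real.rpow_pos_of_pos (bracket_pos x) e
  -- The trade of the largest modulation `x` for the smallest frequency `y`: the square doubles the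
  -- exponent.
  have hstep {x y : ℝ} (hxy : bracket y ^ 2 ≤ C * bracket x) :
      bracket x ^ (-d) ≤ C ^ d * bracket y ^ (-(2 * d)) := by
    have h1 : (bracket y ^ 2) ^ d ≤ C ^ d * bracket x ^ d := by
      rw [← Real.mul_rpow hC.le (bracket_pos x).le]
      exact Real.rpow_le_rpow (by positivity) hxy hd.le
    have h2 : (bracket y ^ 2) ^ d = bracket y ^ (2 * d) := by
      rw [← Real.rpow_natCast, ← Real.rpow_mul (bracket_pos y).le]
      norm_num
    rw [h2] at h1
    rw [Real.rpow_neg (bracket_pos x).le, Real.rpow_neg (bracket_pos y).le, ← div_eq_mul_inv,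
      inv_eq_one_div, div_le_div_iff₀ (hpos _ _) (hpos _ _), one_mul]
    exact h1
  set S := bracket y₀ ^ (-(2 * d)) + bracket y₁ ^ (-(2 * d)) + bracket y₂ ^ (-(2 * d)) with hS
  have hSpos : 0 < S := by positivity [hpos y₀ (-(2 * d)), hpos y₁ (-(2 * d)), hpos y₂ (-(2 * d))]
  have hSle {x : ℝ} (hx : min (bracket y₀) (min (bracket y₁) (bracket y₂)) ^ 2 ≤ C * bracket x) :
      bracket x ^ (-d) ≤ C ^ d * S := by
    have h0 := hpos y₀ (-(2 * d))
    have h1 := hpos y₁ (-(2 * d))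
    have h2 := hpos y₂ (-(2 * d))
    have hCd : 0 < C ^ d := Real.rpow_pos_of_pos hC d
    rcases min_choice (bracket y₀) (min (bracket y₁) (bracket y₂)) with hm | hm
    · rw [hm] at hx
      exact (hstep hx).trans (by gcongr; linarith)
    · rw [hm] at hx
      rcases min_choice (bracket y₁) (bracket y₂) with hm | hm
      · rw [hm] at hx
        exact (hstep hx).trans (by gcongr; linarith)
      · rw [hm] at hx
        exact (hstep hx).trans (by gcongr; linarith)
  simp_rw [bracket_rpow_neg_two_mul x₀, bracket_rpow_neg_two_mul x₁, bracket_rpow_neg_two_mul x₂]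
  have hCS : 0 < C ^ d * S := mul_pos (Real.rpow_pos_of_pos hC d) hSpos
  have p₀ := hpos x₀ (-d)
  have p₁ := hpos x₁ (-d)
  have p₂ := hpos x₂ (-d)
  have hfirst : bracket x₀ ^ (-e₀) * (bracket x₁ ^ (-e₁) * bracket x₂ ^ (-e₂))
      ≤ bracket x₀ ^ (-d) * (bracket x₁ ^ (-d) * bracket x₂ ^ (-d)) := by
    have := hpos x₀ (-e₀)
    have := hpos x₁ (-e₁)
    have := hpos x₂ (-e₂)
    gcongr ?_ * (?_ * ?_)
    exacts [hexp he₀, hexp he₁, hexp he₂]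
  refine hfirst.trans ?_
  set a := bracket x₀ ^ (-d)
  set b := bracket x₁ ^ (-d)
  set c := bracket x₂ ^ (-d)
  -- `w` belongs to the largest modulation. The product `u * v` of the other two is split by `2uv ≤
  -- u² + v²`, leaving terms in a single modulation.
  have hfin {u v w : ℝ} (hu : 0 < u) (hv : 0 < v) (hw : w ≤ C ^ d * S)
      (hle : u * v ≤ a ^ 2 + b ^ 2 + c ^ 2) :
      u * v * w ≤ C ^ d * (a ^ 2 + b ^ 2 + c ^ 2) * S := by
    calc u * v * w ≤ u * v * (C ^ d * S) := by gcongr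
      _ ≤ (a ^ 2 + b ^ 2 + c ^ 2) * (C ^ d * S) := by gcongr
      _ = _ := by ring
  rcases max_choice (bracket x₀) (max (bracket x₁) (bracket x₂)) with hm | hm
  · rw [hm] at h
    have := hfin p₁ p₂ (hSle h) (by nlinarith [sq_nonneg (b - c)])
    linarith
  · rw [hm] at h
    rcases max_choice (bracket x₁) (bracket x₂) with hm | hm
    · rw [hm] at h
      have := hfin p₀ p₂ (hSle h) (by nlinarith [sq_nonneg (a - c)])
      linarith
    · rw [hm] at h
      have := hfin p₀ p₁ (hSle h) (by nlinarith [sq_nonneg (a - b)])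
      linarith

/-- The modulation of the Schrödinger equation. -/
noncomputable def modS (L : ℝ) (n : ℤ) (τ : ℝ) : ℝ := τ + (2 * Real.pi * n / L) ^ 2

/-- The modulation of the Boussinesq equation. -/
noncomputable def modB (L : ℝ) (n : ℤ) (τ : ℝ) : ℝ := |τ| - gammaL L n

/-- Replacing the symbol by its leading quadratic part costs only a bounded error, so the resonance
computation becomes polynomial. -/
theorem gammaL_bounds (L : ℝ) (n : ℤ) :
    (2 * Real.pi / L) ^ 2 * (n : ℝ) ^ 2 ≤ gammaL L n ∧
      gammaL L n ≤ (2 * Real.pi / L) ^ 2 * ((n : ℝ) ^ 2 + 1) := by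
  unfold gammaL
  constructor
  · gcongr
    exact Real.le_sqrt_of_sq_le (by nlinarith [sq_nonneg (n : ℝ)])
  · gcongr
    rw [Real.sqrt_le_left (by positivity)]
    nlinarith [sq_nonneg (n : ℝ)]

/-- With m the smaller of |x| and |y|, m² ≤ |xy| and (1 + m)² ≤ 2 + 2m². -/
theorem sq_min_le_of_abs_mul_le {x y M : ℝ} (h : |x * y| ≤ M) :
    min (bracket x) (bracket y) ^ 2 ≤ 2 + 2 * M := by
  rw [abs_mul] at h
  have hx := abs_nonneg x
  have hy := abs_nonneg y
  unfold bracket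
  rcases le_total |x| |y| with hxy | hxy
  · rw [min_eq_left (by linarith)]
    nlinarith [mul_le_mul_of_nonneg_left hxy hx, sq_nonneg (|x| - 1)]
  · rw [min_eq_right (by linarith)]
    nlinarith [mul_le_mul_of_nonneg_left hxy hy, sq_nonneg (|y| - 1)]

/-- The resonance relation between two Schrödinger modulations and a Boussinesq modulation. -/
theorem resonance {L : ℝ} (hL : 0 < L) (p q : ℤ) (α β : ℝ) :
    min (bracket p) (min (bracket q) (bracket (p - q : ℤ))) ^ 2
      ≤ (5 + 3 / (2 * Real.pi / L) ^ 2) *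
        max (bracket (modS L p α)) (max (bracket (modS L q β)) (bracket (modB L (p - q) (α - β)))) := by
  set κ := (2 * Real.pi / L) ^ 2 with hκ
  have hκpos : 0 < κ := by positivity
  have hS (n : ℤ) (τ : ℝ) : modS L n τ = τ + κ * (n : ℝ) ^ 2 := by
    rw [modS, hκ]
    ring
  obtain ⟨hγ1, hγ2⟩ := gammaL_bounds L (p - q)
  rw [← hκ] at hγ1 hγ2
  push_cast at hγ1 hγ2
  set W := max (bracket (modS L p α))
    (max (bracket (modS L q β)) (bracket (modB L (p - q) (α - β)))) with hW
  have h1 : bracket (modS L p α) ≤ W := le_max_left _ _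
  have h2 : bracket (modS L q β) ≤ W := (le_max_left _ _).trans (le_max_right _ _)
  have h3 : bracket (modB L (p - q) (α - β)) ≤ W := (le_max_right _ _).trans (le_max_right _ _)
  have hW1 : 1 ≤ W := (one_le_bracket _).trans h1
  unfold bracket at h1 h2 h3
  rw [hS] at h1 h2
  rw [modB] at h3
  obtain ⟨h1a, h1b⟩ := abs_le.1 (show |α + κ * (p : ℝ) ^ 2| ≤ W by linarith)
  obtain ⟨h2a, h2b⟩ := abs_le.1 (show |β + κ * (q : ℝ) ^ 2| ≤ W by linarith)
  obtain ⟨h3a, h3b⟩ := abs_le.1 (show |(|α - β| - gammaL L (p - q))| ≤ W by linarith)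
  -- `2κxy` is a signed sum of three modulations, each at most `W`, up to the error `κ` from
  -- `gammaL_bounds`.
  have hdone {x y : ℝ} (hxy : κ * |x * y| ≤ (3 * W + κ) / 2)
      (hmin : min (bracket p) (min (bracket q) (bracket (p - q : ℤ)))
        ≤ min (bracket x) (bracket y)) :
      min (bracket p) (min (bracket q) (bracket (p - q : ℤ))) ^ 2 ≤ (5 + 3 / κ) * W := by
    have h0 : 0 ≤ min (bracket p) (min (bracket q) (bracket (p - q : ℤ))) :=
      le_min (bracket_pos _).le (le_min (bracket_pos _).le (bracket_pos _).le)
    have hM : |x * y| ≤ (3 * W + κ) / 2 / κ := by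
      rw [le_div_iff₀ hκpos]
      linarith
    calc _ ≤ min (bracket x) (bracket y) ^ 2 := by gcongr
      _ ≤ 2 + 2 * ((3 * W + κ) / 2 / κ) := sq_min_le_of_abs_mul_le hM
      _ = 3 + 3 / κ * W := by field_simp; ring
      _ ≤ (5 + 3 / κ) * W := by nlinarith
  -- The sign decides which identity applies: `p² - q² + (p - q)² = 2p(p - q)` or `p² - q² - (p -
  -- q)² = 2q(p - q)`.
  rcases le_total 0 (α - β) with hs | hs
  · rw [abs_of_nonneg hs] at h3a h3b
    refine hdone (x := p) (y := (p - q : ℤ)) ?_ ?_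
    · rw [← abs_of_pos hκpos, ← abs_mul, abs_of_pos hκpos, abs_le]
      push_cast
      constructor <;> nlinarith
    · exact le_min (min_le_left _ _) ((min_le_right _ _).trans (min_le_right _ _))
  · rw [abs_of_nonpos hs] at h3a h3b
    refine hdone (x := q) (y := (p - q : ℤ)) ?_ ?_
    · rw [← abs_of_pos hκpos, ← abs_mul, abs_of_pos hκpos, abs_le]
      push_cast
      constructor <;> nlinarith
    · exact min_le_right _ _

end Weights

/-! ### Weighted convolution estimates on the Fourier side -/

section FourierSide

theorem measurable_modS (L : ℝ) (n : ℤ) : Measurable (modS L n) := by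
  unfold modS
  fun_prop

theorem measurable_modB (L : ℝ) (n : ℤ) : Measurable (modB L n) := by
  unfold modB
  fun_prop

theorem measurable_ofReal_bracket_rpow {f : ℝ → ℝ} (hf : Measurable f) (e : ℝ) :
    Measurable fun τ => ENNReal.ofReal (bracket (f τ) ^ e) :=
  ((measurable_bracket.comp hf).pow_const e).ennreal_ofReal

theorem ofReal_bracket_rpow_sq (x d : ℝ) :
    ENNReal.ofReal (bracket x ^ (-(2 * d))) ^ 2 = ENNReal.ofReal (bracket x ^ (-(4 * d))) := by
  rw [← ENNReal.ofReal_pow (Real.rpow_nonneg (bracket_pos x).le _), ← Real.rpow_natCast,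
    ← Real.rpow_mul (bracket_pos x).le]
  congr 2
  push_cast
  ring

/-- The threshold 1/4 enters here: the square of a bracket to the power -2d is integrable exactly
when 4d > 1. -/
theorem lintegral_bracket_rpow_lt_top {d : ℝ} (hd : 1 / 4 < d) :
    ∫⁻ x, ENNReal.ofReal (bracket x ^ (-(4 * d))) < ⊤ := by
  have := finite_integral_one_add_norm (E := ℝ) (μ := volume) (r := 4 * d) (by simp; linarith)
  simpa [bracket] using this

/-- Uniformity in `n` is translation invariance in `τ`. For the Boussinesq modulation, `|τ|` is `τ`
or `-τ`, so two translates are needed, whence `I + I`. -/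
theorem exists_normL2_modulation_le {d : ℝ} (hd : 1 / 4 < d) (L : ℝ) :
    ∃ A : ℝ≥0∞, A ≠ ⊤ ∧
      (∀ n, normL2 volume (fun τ => ENNReal.ofReal (bracket (modS L n τ) ^ (-(2 * d)))) ≤ A) ∧
      (∀ n, normL2 volume (fun τ => ENNReal.ofReal (bracket (modB L n τ) ^ (-(2 * d)))) ≤ A) := by
  have hfin := lintegral_bracket_rpow_lt_top hd
  set I := ∫⁻ x, ENNReal.ofReal (bracket x ^ (-(4 * d))) with hI
  refine ⟨(I + I) ^ (1 / 2 : ℝ),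
    ENNReal.rpow_ne_top_of_nonneg (by norm_num) (ENNReal.add_lt_top.2 ⟨hfin, hfin⟩).ne,
    fun n => ?_, fun n => ?_⟩
  · unfold normL2 modS
    simp_rw [ofReal_bracket_rpow_sq]
    rw [lintegral_add_right_eq_self (fun τ => ENNReal.ofReal (bracket τ ^ (-(4 * d)))), ← hI]
    gcongr
    exact le_self_add
  · unfold normL2 modB
    simp_rw [ofReal_bracket_rpow_sq]
    gcongr
    calc ∫⁻ τ, ENNReal.ofReal (bracket (|τ| - gammaL L n) ^ (-(4 * d)))
        ≤ ∫⁻ τ, (ENNReal.ofReal (bracket (τ - gammaL L n) ^ (-(4 * d)))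
          + ENNReal.ofReal (bracket (τ + gammaL L n) ^ (-(4 * d)))) := by
          refine lintegral_mono fun τ => ?_
          rcases abs_choice τ with h | h
          · rw [h]
            exact le_self_add
          · rw [h, show bracket (-τ - gammaL L n) = bracket (τ + gammaL L n) by
              rw [bracket, bracket, ← abs_neg]; ring_nf]
            exact le_add_self
      _ = I + I := by
          rw [lintegral_add_left (measurable_ofReal_bracket_rpow (by fun_prop) _),
            lintegral_sub_right_eq_self (fun τ => ENNReal.ofReal (bracket τ ^ (-(4 * d)))),
            lintegral_add_right_eq_self (fun τ => ENNReal.ofReal (bracket τ ^ (-(4 * d))))]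

theorem normL2_frequency_ne_top {d : ℝ} (hd : 1 / 4 < d) :
    normL2 Measure.count (fun n : ℤ => ENNReal.ofReal (bracket (n : ℝ) ^ (-(2 * d)))) ≠ ⊤ := by
  unfold normL2
  refine ENNReal.rpow_ne_top_of_nonneg (by norm_num) ?_
  simp_rw [ofReal_bracket_rpow_sq]
  rw [lintegral_count]
  have hnat : Summable fun n : ℕ => bracket ((n : ℤ) : ℝ) ^ (-(4 * d)) := by
    have := (summable_nat_add_iff 1).2 (Real.summable_nat_rpow.2 (show -(4 * d) < -1 by linarith))
    refine this.congr fun n => ?_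
    rw [bracket, Int.cast_natCast, abs_of_nonneg (Nat.cast_nonneg n), Nat.cast_add, Nat.cast_one,
      add_comm]
  have hsum : Summable fun n : ℤ => bracket (n : ℝ) ^ (-(4 * d)) := by
    refine Summable.of_nat_of_neg hnat (hnat.congr fun n => ?_)
    simp [bracket]
  exact hsum.tsum_ofReal_ne_top

/-- The weighted convolution estimates on the Fourier side. -/
theorem exists_weighted_corr_le {L : ℝ} (hL : 0 < L) {d : ℝ} (hd : 1 / 4 < d) :
    ∃ C : ℝ≥0∞, C ≠ ⊤ ∧ ∀ (e₀ e₁ e₂ : ℝ), d ≤ e₀ → d ≤ e₁ → d ≤ e₂ →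
      ∀ f g : ℤ → ℝ → ℝ≥0∞, (∀ n, Measurable (f n)) → (∀ n, Measurable (g n)) →
      seqNormL2 (fun n τ => ENNReal.ofReal (bracket (modS L n τ) ^ (-e₀)) * seqCorr
        (fun m s => ENNReal.ofReal (bracket (modS L m s) ^ (-e₁)) * f m s)
        (fun m s => ENNReal.ofReal (bracket (modB L m s) ^ (-e₂)) * g m s) n τ)
        ≤ C * (seqNormL2 f * seqNormL2 g) ∧
      seqNormL2 (fun n τ => ENNReal.ofReal (bracket (modB L n τ) ^ (-e₀)) * seqCorr
        (fun m s => ENNReal.ofReal (bracket (modS L m s) ^ (-e₁)) * f m s)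
        (fun m s => ENNReal.ofReal (bracket (modS L m s) ^ (-e₂)) * g m s) n τ)
        ≤ C * (seqNormL2 f * seqNormL2 g) := by
  obtain ⟨A, hA, hAS, hAB⟩ := exists_normL2_modulation_le hd L
  set β : ℤ → ℝ≥0∞ := fun n => ENNReal.ofReal (bracket (n : ℝ) ^ (-(2 * d))) with hβ
  have hB := normL2_frequency_ne_top hd
  rw [← hβ] at hB
  set D : ℝ := 5 + 3 / (2 * Real.pi / L) ^ 2 with hD
  have hDpos : 0 < D := by positivity
  set E := ENNReal.ofReal (D ^ d) with hE
  set B := normL2 Measure.count β with hBdef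
  have hd0 : 0 < d := by linarith
  refine ⟨(E * A + E * A + E * A) * (B + B + B), ?_, ?_⟩
  · finiteness
  intro e₀ e₁ e₂ he₀ he₁ he₂ f g hf hg
  have hmS (e : ℝ) (n : ℤ) := measurable_ofReal_bracket_rpow (measurable_modS L n) e
  have hmB (e : ℝ) (n : ℤ) := measurable_ofReal_bracket_rpow (measurable_modB L n) e
  have hbd (ρ : ℤ → ℝ → ℝ) (hm : ∀ n, Measurable (ρ n))
      (h : ∀ n, normL2 volume (fun τ => ENNReal.ofReal (bracket (ρ n τ) ^ (-(2 * d)))) ≤ A)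
      (n : ℤ) : normL2 volume (fun τ => E * ENNReal.ofReal (bracket (ρ n τ) ^ (-(2 * d))))
        ≤ E * A := by
    rw [normL2_const_mul _ (measurable_ofReal_bracket_rpow (hm n) _)]
    gcongr
    exact h n
  have hker {x₀ x₁ x₂ : ℝ} {y₀ y₁ y₂ : ℤ}
      (h : min (bracket y₀) (min (bracket y₁) (bracket y₂)) ^ 2
        ≤ D * max (bracket x₀) (max (bracket x₁) (bracket x₂))) :
      ENNReal.ofReal (bracket x₀ ^ (-e₀)) * (ENNReal.ofReal (bracket x₁ ^ (-e₁)) *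
        ENNReal.ofReal (bracket x₂ ^ (-e₂)))
      ≤ (E * ENNReal.ofReal (bracket x₀ ^ (-(2 * d))) + E * ENNReal.ofReal (bracket x₁ ^ (-(2 * d)))
        + E * ENNReal.ofReal (bracket x₂ ^ (-(2 * d)))) * (β y₀ + β y₁ + β y₂) := by
    have hp (x e : ℝ) : 0 ≤ bracket x ^ e := Real.rpow_nonneg (bracket_pos x).le e
    rw [← mul_add, ← mul_add, hE, hβ]
    dsimp only
    rw [← ENNReal.ofReal_mul (hp _ _), ← ENNReal.ofReal_mul (hp _ _),
      ← ENNReal.ofReal_add (hp _ _) (hp _ _),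
      ← ENNReal.ofReal_add (add_nonneg (hp _ _) (hp _ _)) (hp _ _),
      ← ENNReal.ofReal_add (hp _ _) (hp _ _),
      ← ENNReal.ofReal_add (add_nonneg (hp _ _) (hp _ _)) (hp _ _),
      ← ENNReal.ofReal_mul (by positivity), ← ENNReal.ofReal_mul]
    · exact ENNReal.ofReal_le_ofReal (weight_prod_le hDpos hd0 he₀ he₁ he₂ h)
    · have := hp x₀ (-(2 * d))
      have := hp x₁ (-(2 * d))
      have := hp x₂ (-(2 * d))
      positivity
  constructor
  · refine seqNormL2_weighted_corr_le (β := β) (hmS _) (hmS _) (hmB _)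
      (fun n => (hmS (-(2 * d)) n).const_mul E) (fun n => (hmS (-(2 * d)) n).const_mul E)
      (fun n => (hmB (-(2 * d)) n).const_mul E) hf hg (hbd _ (measurable_modS L) hAS)
      (hbd _ (measurable_modS L) hAS) (hbd _ (measurable_modB L) hAB) fun n τ m s => hker ?_
    rw [min_left_comm, max_left_comm]
    exact resonance hL m n s τ
  · refine seqNormL2_weighted_corr_le (β := β) (hmB _) (hmS _) (hmS _)
      (fun n => (hmB (-(2 * d)) n).const_mul E) (fun n => (hmS (-(2 * d)) n).const_mul E)
      (fun n => (hmS (-(2 * d)) n).const_mul E) hf hg (hbd _ (measurable_modB L) hAB)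
      (hbd _ (measurable_modS L) hAS) (hbd _ (measurable_modS L) hAS) fun n τ m s => hker ?_
    -- Here the output carries the Boussinesq modulation: `p - q = n` and `α - β = τ`. In the
    -- previous case it was carried by the second factor.
    have := resonance hL m (m - n) s (s - τ)
    rw [sub_sub_cancel, sub_sub_cancel, ← min_assoc, ← max_assoc] at this
    rwa [min_comm (bracket n), max_comm (bracket (modB L n τ))]

end FourierSide

/-! ### Uniqueness of functions tested against Schwartz functions -/

section LocallyIntegrable

/-- For every `R` there is a Schwartz function equal to `1` on the ball of radius `R`. -/
theorem exists_schwartz_eq_one (R : ℝ) :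
    ∃ φ : 𝓢(ℝ, ℂ), ∀ t : ℝ, |t| ≤ R → φ t = 1 := by
  let b : ContDiffBump (0 : ℝ) := ⟨|R| + 1, |R| + 2, by positivity, by linarith⟩
  have h1 : HasCompactSupport fun t => ((b t : ℝ) : ℂ) :=
    b.hasCompactSupport.comp_left Complex.ofReal_zero
  have h2 : ContDiff ℝ (⊤ : ℕ∞) fun t => ((b t : ℝ) : ℂ) :=
    Complex.ofRealCLM.contDiff.comp b.contDiff
  refine ⟨h1.toSchwartzMap h2, fun t ht => ?_⟩
  have : b t = 1 := b.one_of_mem_closedBall (by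
    simp only [Metric.mem_closedBall, dist_zero_right, Real.norm_eq_abs]
    exact ht.trans ((le_abs_self R).trans (by change |R| ≤ |R| + 1; linarith)))
  simp [this]

theorem locallyIntegrable_of_integrable_mul_schwartz {u : ℝ → ℂ}
    (hu : ∀ φ : 𝓢(ℝ, ℂ), Integrable fun t => u t * φ t) : LocallyIntegrable u := by
  rw [locallyIntegrable_iff]
  intro K hK
  obtain ⟨R, hR⟩ := hK.isBounded.exists_norm_le
  obtain ⟨φ, hφ⟩ := exists_schwartz_eq_one R
  refine ((hu φ).integrableOn (s := K)).congr_fun (fun t ht => ?_) hK.measurableSet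
  simp [hφ t (hR t ht)]

theorem ae_eq_of_integral_mul_schwartz {u v : ℝ → ℂ}
    (hu : ∀ φ : 𝓢(ℝ, ℂ), Integrable fun t => u t * φ t)
    (hv : ∀ φ : 𝓢(ℝ, ℂ), Integrable fun t => v t * φ t)
    (h : ∀ φ : 𝓢(ℝ, ℂ), ∫ t, u t * φ t = ∫ t, v t * φ t) : u =ᵐ[volume] v := by
  have := ae_eq_zero_of_integral_contDiff_smul_eq_zero (μ := volume) (f := fun t => u t - v t)
    ((locallyIntegrable_of_integrable_mul_schwartz hu).sub
      (locallyIntegrable_of_integrable_mul_schwartz hv)) fun g hg hgc => ?_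
  · filter_upwards [this] with t ht
    exact sub_eq_zero.1 ht
  · have h1 : HasCompactSupport fun t => ((g t : ℝ) : ℂ) := hgc.comp_left Complex.ofReal_zero
    have h2 : ContDiff ℝ (⊤ : ℕ∞) fun t => ((g t : ℝ) : ℂ) := Complex.ofRealCLM.contDiff.comp hg
    have key := h (h1.toSchwartzMap h2)
    have e : (fun t => g t • (u t - v t)) =
        fun t => u t * (h1.toSchwartzMap h2) t - v t * (h1.toSchwartzMap h2) t := by
      ext t
      simp
      ring
    rw [e, integral_sub (hu _) (hv _), key, sub_self]

end LocallyIntegrable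

/-! ### Plancherel on the line for distributional Fourier transforms -/

section Line

open scoped FourierTransform

/-- `U` is the Fourier transform of `u` in the sense of tempered distributions on the line, with
the kernel `e^{-itτ}`. -/
structure IsLineFourier (u U : ℝ → ℂ) : Prop where
  integrable_left : ∀ φ : 𝓢(ℝ, ℂ), Integrable fun t => u t * φ t
  integral_eq : ∀ φ : 𝓢(ℝ, ℂ),
    ∫ t : ℝ, u t * (∫ τ : ℝ, Complex.exp (-(Complex.I * (t : ℂ) * (τ : ℂ))) * φ τ)
      = ∫ τ : ℝ, U τ * φ τ

/-- Dilation by 2π passes between the kernel `e^{-itτ}` and the kernel `e^{-2πitτ}` of `𝓕`. -/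
theorem integral_exp_mul_schwartz (φ : 𝓢(ℝ, ℂ)) (t : ℝ) :
    ∫ τ : ℝ, Complex.exp (-(Complex.I * ((2 * Real.pi * t : ℝ) : ℂ) * (τ : ℂ))) * φ τ
      = 𝓕 φ t := by
  rw [SchwartzMap.fourier_coe, Real.fourier_real_eq_integral_exp_smul]
  congr! 2 with τ
  rw [smul_eq_mul]
  congr 2
  push_cast
  ring

theorem exists_schwartz_dilation (φ : 𝓢(ℝ, ℂ)) {c : ℝ} (hc : c ≠ 0) :
    ∃ ψ : 𝓢(ℝ, ℂ), ∀ t : ℝ, ψ t = φ (c * t) :=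
  ⟨SchwartzMap.compCLMOfContinuousLinearEquiv ℂ
    (ContinuousLinearEquiv.smulLeft (Units.mk0 c hc)) φ, fun _ => rfl⟩

theorem exists_integral_exp_mul_schwartz (φ : 𝓢(ℝ, ℂ)) :
    ∃ ψ : 𝓢(ℝ, ℂ), ∀ t : ℝ,
      ∫ τ : ℝ, Complex.exp (-(Complex.I * (t : ℂ) * (τ : ℂ))) * φ τ = ψ t := by
  have hπ : (2 * Real.pi)⁻¹ ≠ 0 := by positivity
  obtain ⟨ψ, hψ⟩ := exists_schwartz_dilation (𝓕 φ) hπ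
  refine ⟨ψ, fun t => ?_⟩
  rw [hψ, ← integral_exp_mul_schwartz, mul_inv_cancel_left₀ (by positivity)]

theorem integrable_Lp_mul_schwartz (g : Lp ℂ 2 (volume : Measure ℝ)) (φ : 𝓢(ℝ, ℂ)) :
    Integrable fun t => g t * φ t :=
  (Lp.memLp g).integrable_mul (φ.memLp 2)

/-- A function whose Fourier transform is in `L²` is, after rescaling, the inverse Fourier
transform in `L²`. -/
theorem IsLineFourier.rescale_ae_eq {u U : ℝ → ℂ} (h : IsLineFourier u U) (hU : MemLp U 2) :
    (fun t => (2 * Real.pi : ℂ) * u (2 * Real.pi * t)) =ᵐ[volume] (𝓕⁻ (hU.toLp U) : Lp ℂ 2 volume) := by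
  have hπ : (2 * Real.pi) ≠ 0 := by positivity
  set g : Lp ℂ 2 (volume : Measure ℝ) := 𝓕⁻ (hU.toLp U) with hg
  refine ae_eq_of_integral_mul_schwartz (fun φ => ?_) (integrable_Lp_mul_schwartz g) fun ψ => ?_
  · obtain ⟨ψ, hψ⟩ := exists_schwartz_dilation φ (inv_ne_zero hπ)
    have := ((h.integrable_left ψ).comp_mul_left' hπ).const_mul (2 * Real.pi : ℂ)
    refine this.congr (ae_of_all _ fun t => ?_)
    simp only
    rw [hψ, inv_mul_cancel_left₀ hπ]
    ring
  -- Every test function is a transform `ψ = 𝓕 φ`, so both sides can be moved to the Fourier side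
  -- and compared against `φ`.
  · set φ : 𝓢(ℝ, ℂ) := 𝓕⁻ ψ with hφ
    have hψ : ψ = 𝓕 φ := by simp [hφ]
    have h1 : ∫ t, (2 * Real.pi : ℂ) * u (2 * Real.pi * t) * ψ t = ∫ τ, U τ * φ τ := by
      rw [← h.integral_eq]
      set G : ℝ → ℂ := fun t =>
        u t * ∫ τ : ℝ, Complex.exp (-(Complex.I * (t : ℂ) * (τ : ℂ))) * φ τ with hG
      have e : (fun t => (2 * Real.pi : ℂ) * u (2 * Real.pi * t) * ψ t)
          = fun t => (2 * Real.pi : ℂ) * G (2 * Real.pi * t) := by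
        ext t
        rw [hG]
        dsimp only
        rw [integral_exp_mul_schwartz, hψ, mul_assoc]
      rw [e, integral_const_mul, Measure.integral_comp_mul_left G (2 * Real.pi),
        abs_of_pos (by positivity), Complex.real_smul]
      push_cast
      rw [mul_inv_cancel_left₀ (by exact_mod_cast hπ)]
    have h2 := congrArg (fun T : 𝓢'(ℝ, ℂ) => T φ) (Lp.fourier_toTemperedDistribution_eq g)
    simp only [TemperedDistribution.fourier_apply, Lp.toTemperedDistribution_apply, ← hψ,
      smul_eq_mul] at h2
    rw [h1]
    calc ∫ τ, U τ * φ τ = ∫ τ, φ τ * (hU.toLp U : ℝ → ℂ) τ := by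
          refine integral_congr_ae ?_
          filter_upwards [hU.coeFn_toLp] with τ hτ
          rw [hτ, mul_comm]
      _ = ∫ t, ψ t * g t := by
          rw [h2, hg, FourierTransform.fourier_fourierInv_eq]
      _ = ∫ t, g t * ψ t := by simp_rw [mul_comm]

theorem IsLineFourier.memLp {u U : ℝ → ℂ} (h : IsLineFourier u U) (hU : MemLp U 2) :
    MemLp u 2 := by
  have hπ : (2 * Real.pi) ≠ 0 := by positivity
  have h1 := (Lp.memLp (𝓕⁻ (hU.toLp U) : Lp ℂ 2 volume)).ae_eq (h.rescale_ae_eq hU).symm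
  have h2 := (memLp_two_iff_integrable_sq_norm h1.1).1 h1
  -- Undoes the dilation and the factor 2π of `rescale_ae_eq`.
  have h3 := (h2.comp_mul_left' (inv_ne_zero hπ)).const_mul (((2 * Real.pi) ^ 2)⁻¹)
  have hmeas := (locallyIntegrable_of_integrable_mul_schwartz h.integrable_left).aestronglyMeasurable
  rw [memLp_two_iff_integrable_sq_norm hmeas]
  refine h3.congr (ae_of_all _ fun t => ?_)
  simp only
  have : ‖(2 * Real.pi : ℂ)‖ = 2 * Real.pi := by
    rw [norm_mul, Complex.norm_real, Real.norm_of_nonneg Real.pi_pos.le]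
    simp
  rw [mul_inv_cancel_left₀ hπ, norm_mul, this]
  field_simp

/-- Plancherel's identity. -/
theorem IsLineFourier.integral_mul_conj {u U v V : ℝ → ℂ} (hu : IsLineFourier u U)
    (hv : IsLineFourier v V) (hU : MemLp U 2) (hV : MemLp V 2) :
    ∫ t, u t * conj (v t) = (2 * Real.pi : ℂ)⁻¹ * ∫ τ, U τ * conj (V τ) := by
  have hπ : (2 * Real.pi) ≠ 0 := by positivity
  have hπ' : (2 * Real.pi : ℂ) ≠ 0 := by exact_mod_cast hπ
  have h1 : inner ℂ (𝓕⁻ (hV.toLp V) : Lp ℂ 2 volume) (𝓕⁻ (hU.toLp U) : Lp ℂ 2 volume)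
      = inner ℂ (hV.toLp V) (hU.toLp U) :=
    (Lp.fourierTransformₗᵢ ℝ ℂ).symm.inner_map_map _ _
  rw [L2.inner_def, L2.inner_def] at h1
  have h2 : ∫ t, inner ℂ ((hV.toLp V : ℝ → ℂ) t) ((hU.toLp U : ℝ → ℂ) t)
      = ∫ τ, U τ * conj (V τ) := by
    refine integral_congr_ae ?_
    filter_upwards [hU.coeFn_toLp, hV.coeFn_toLp] with τ h1 h2
    rw [h1, h2, RCLike.inner_apply]
  have h3 : ∫ t, inner ℂ ((𝓕⁻ (hV.toLp V) : Lp ℂ 2 volume) t) ((𝓕⁻ (hU.toLp U) : Lp ℂ 2 volume) t)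
      = ∫ t, (2 * Real.pi : ℂ) ^ 2 * (fun r => u r * conj (v r)) (2 * Real.pi * t) := by
    refine integral_congr_ae ?_
    filter_upwards [hu.rescale_ae_eq hU, hv.rescale_ae_eq hV] with t h1 h2
    rw [← h1, ← h2, RCLike.inner_apply]
    simp only [map_mul, Complex.conj_ofReal, map_ofNat]
    ring
  rw [h2, h3, integral_const_mul, Measure.integral_comp_mul_left (fun r => u r * conj (v r)),
    abs_of_pos (by positivity), Complex.real_smul] at h1
  rw [← h1]
  push_cast
  field_simp

end Line

/-- Plancherel carries the factor 1/(2π) ≤ 1, which is dropped here and in the next lemma since only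
upper bounds are needed. -/
theorem IsLineFourier.lintegral_enorm_sq_le {u U : ℝ → ℂ} (h : IsLineFourier u U)
    (hU : MemLp U 2) : ∫⁻ t, ‖u t‖ₑ ^ 2 ≤ ∫⁻ τ, ‖U τ‖ₑ ^ 2 := by
  have conv {f : ℝ → ℂ} (hf : MemLp f 2) :
      ∫⁻ t, ‖f t‖ₑ ^ 2 = ENNReal.ofReal (∫ t, ‖f t‖ ^ 2) := by
    rw [ofReal_integral_eq_lintegral_ofReal ((memLp_two_iff_integrable_sq_norm hf.1).1 hf)
      (ae_of_all _ fun t => by positivity)]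
    congr! 2 with t
    rw [ENNReal.ofReal_pow (norm_nonneg _), ofReal_norm]
  have key := h.integral_mul_conj h hU hU
  simp_rw [Complex.mul_conj, Complex.normSq_eq_norm_sq] at key
  rw [integral_complex_ofReal, integral_complex_ofReal] at key
  have key' : ∫ t, ‖u t‖ ^ 2 = (2 * Real.pi)⁻¹ * ∫ τ, ‖U τ‖ ^ 2 := by exact_mod_cast key
  rw [conv (h.memLp hU), conv hU, key']
  refine ENNReal.ofReal_le_ofReal (mul_le_of_le_one_left (by positivity) ?_)
  exact inv_le_one_of_one_le₀ (by linarith [Real.pi_gt_three])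

theorem IsLineFourier.enorm_integral_mul_conj_le {u U v V : ℝ → ℂ} (hu : IsLineFourier u U)
    (hv : IsLineFourier v V) (hU : MemLp U 2) (hV : MemLp V 2) :
    ‖∫ t, u t * conj (v t)‖ₑ ≤ ∫⁻ τ, ‖U τ‖ₑ * ‖V τ‖ₑ := by
  rw [hu.integral_mul_conj hv hU hV, enorm_mul]
  have h1 : ‖(2 * Real.pi : ℂ)⁻¹‖ₑ ≤ 1 := by
    rw [← ofReal_norm, ENNReal.ofReal_le_one, norm_inv, norm_mul, Complex.norm_real,
      Real.norm_of_nonneg Real.pi_pos.le]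
    refine inv_le_one_of_one_le₀ ?_
    simp only [Complex.norm_ofNat]
    linarith [Real.pi_gt_three]
  calc _ ≤ 1 * ‖∫ τ, U τ * conj (V τ)‖ₑ := by gcongr
    _ ≤ ∫⁻ τ, ‖U τ * conj (V τ)‖ₑ := by
      rw [one_mul]
      exact enorm_integral_le_lintegral_enorm _
    _ = _ := by simp_rw [enorm_mul, RCLike.enorm_conj]

/-! ### Parseval on the circle for integrable functions -/

section Circle

open AddCircle

variable {L : ℝ} [Fact (0 < L)]

/-- The pairing with `f` is continuous in the sup norm, so its kernel is closed; it contains the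
characters, whose span is dense. -/
theorem integral_continuousMap_mul_eq_zero {f : AddCircle L → ℂ}
    (hf : Integrable f haarAddCircle) (h : ∀ n, fourierCoeff f n = 0) (g : C(AddCircle L, ℂ)) :
    ∫ x, g x * f x ∂haarAddCircle = 0 := by
  have hint (g : C(AddCircle L, ℂ)) : Integrable (fun x => g x * f x) haarAddCircle :=
    hf.bdd_mul (c := ‖g‖) g.continuous.aestronglyMeasurable (ae_of_all _ g.norm_coe_le_norm)
  let T : C(AddCircle L, ℂ) →ₗ[ℂ] ℂ :=
    { toFun := fun g => ∫ x, g x * f x ∂haarAddCircle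
      map_add' := fun g₁ g₂ => by
        simp only [ContinuousMap.add_apply, add_mul]
        exact integral_add (hint g₁) (hint g₂)
      map_smul' := fun c g => by
        simp only [ContinuousMap.smul_apply, smul_eq_mul, mul_assoc, RingHom.id_apply]
        exact integral_const_mul _ _ }
  have hT : Continuous T := by
    refine T.mkContinuous (∫ x, ‖f x‖ ∂haarAddCircle) (fun g => ?_) |>.continuous
    rw [mul_comm, ← integral_const_mul]
    refine norm_integral_le_of_norm_le (hf.norm.const_mul _) (ae_of_all _ fun x => ?_)
    rw [norm_mul]
    gcongr
    exact g.norm_coe_le_norm x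
  have hspan : Submodule.span ℂ (Set.range (@fourier L)) ≤ LinearMap.ker T := by
    rw [Submodule.span_le]
    rintro _ ⟨n, rfl⟩
    have := h (-n)
    simpa [fourierCoeff, T] using this
  have hclosed : IsClosed (LinearMap.ker T : Set C(AddCircle L, ℂ)) :=
    isClosed_singleton.preimage hT
  have := Submodule.topologicalClosure_minimal _ hspan hclosed
  rw [span_fourier_closure_eq_top] at this
  exact this (Submodule.mem_top (x := g))

/-- An integrable function on the circle is determined by its Fourier coefficients. -/
theorem ae_eq_zero_of_fourierCoeff_eq_zero {f : AddCircle L → ℂ}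
    (hf : Integrable f haarAddCircle) (h : ∀ n, fourierCoeff f n = 0) :
    f =ᵐ[haarAddCircle] 0 := by
  refine ae_eq_zero_of_forall_setIntegral_isClosed_eq_zero hf fun s hs => ?_
  -- The indicator of a closed set is a pointwise limit of continuous functions bounded by 1, whose
  -- pairings with `f` vanish.
  have hlim : Tendsto (fun k => ∫ x, ((hs.apprSeq k x : ℝ) : ℂ) * f x ∂haarAddCircle) atTop
      (𝓝 (∫ x, s.indicator f x ∂haarAddCircle)) := by
    refine tendsto_integral_of_dominated_convergence (fun x => ‖f x‖) (fun k => ?_) hf.norm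
      (fun k => ae_of_all _ fun x => ?_) (ae_of_all _ fun x => ?_)
    · refine AEStronglyMeasurable.mul ?_ hf.1
      have : Continuous fun x => ((hs.apprSeq k x : ℝ) : ℂ) :=
        Complex.continuous_ofReal.comp (NNReal.continuous_coe.comp (hs.apprSeq k).continuous)
      exact this.aestronglyMeasurable
    · rw [norm_mul, Complex.norm_real, Real.norm_of_nonneg (NNReal.coe_nonneg _)]
      refine mul_le_of_le_one_left (norm_nonneg _) ?_
      exact_mod_cast HasOuterApproxClosed.apprSeq_apply_le_one hs k x
    · have h1 := (tendsto_pi_nhds.1 (HasOuterApproxClosed.tendsto_apprSeq hs)) x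
      have h2 : Tendsto (fun k => ((hs.apprSeq k x : ℝ) : ℂ)) atTop
          (𝓝 (((s.indicator (fun _ => (1 : NNReal)) x : NNReal) : ℝ) : ℂ)) :=
        ((Complex.continuous_ofReal.comp NNReal.continuous_coe).tendsto _).comp h1
      have h3 := h2.mul_const (f x)
      by_cases hx : x ∈ s <;> simpa [hx] using h3
  have hzero (k : ℕ) : ∫ x, ((hs.apprSeq k x : ℝ) : ℂ) * f x ∂haarAddCircle = 0 :=
    integral_continuousMap_mul_eq_zero hf h
      ⟨fun x => ((hs.apprSeq k x : ℝ) : ℂ),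
        Complex.continuous_ofReal.comp (NNReal.continuous_coe.comp (hs.apprSeq k).continuous)⟩
  simp_rw [hzero] at hlim
  rw [← integral_indicator hs.measurableSet]
  exact (tendsto_nhds_unique hlim tendsto_const_nhds)

/-- An integrable function on the circle with square summable Fourier coefficients is the sum of
its Fourier series in `L²`. -/
theorem exists_Lp_ae_eq_of_summable {f : AddCircle L → ℂ} (hf : Integrable f haarAddCircle)
    (hs : Summable fun n => ‖fourierCoeff f n‖ ^ 2) :
    ∃ g : Lp ℂ 2 (haarAddCircle (T := L)), f =ᵐ[haarAddCircle] g ∧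
      ∀ n, fourierBasis.repr g n = fourierCoeff f n := by
  have hmem : Memℓp (fourierCoeff f) 2 := by
    refine memℓp_gen ?_
    simpa using hs
  -- Riesz-Fischer gives an L² function with these coefficients; uniqueness in L¹ identifies it with
  -- `f`.
  set a : lp (fun _ : ℤ => ℂ) 2 := ⟨fourierCoeff f, hmem⟩ with ha
  refine ⟨fourierBasis.repr.symm a, ?_, fun n => ?_⟩
  · have hg : Integrable (fourierBasis.repr.symm a : Lp ℂ 2 (haarAddCircle (T := L)))
        haarAddCircle := (Lp.memLp _).integrable (by norm_num)
    have hcoeff (n : ℤ) :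
        fourierCoeff (fourierBasis.repr.symm a : Lp ℂ 2 (haarAddCircle (T := L))) n
          = fourierCoeff f n := by
      rw [← fourierBasis_repr, LinearIsometryEquiv.apply_symm_apply]
    have h0 := ae_eq_zero_of_fourierCoeff_eq_zero (hf.sub hg) fun n => by
      have : fourierCoeff (f -
          ((fourierBasis.repr.symm a : Lp ℂ 2 (haarAddCircle (T := L))) : AddCircle L → ℂ)) n
          = fourierCoeff f n
            - fourierCoeff (fourierBasis.repr.symm a : Lp ℂ 2 (haarAddCircle (T := L))) n := by
        unfold fourierCoeff
        rw [← integral_sub (hf.fourier_smul _) (hg.fourier_smul _)]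
        simp_rw [Pi.sub_apply, smul_sub]
      rw [this, hcoeff, sub_self]
    filter_upwards [h0] with x hx
    exact sub_eq_zero.1 hx
  · rw [LinearIsometryEquiv.apply_symm_apply]

theorem lintegral_enorm_sq_eq_tsum {f : AddCircle L → ℂ} (hf : Integrable f haarAddCircle)
    (hs : Summable fun n => ‖fourierCoeff f n‖ ^ 2) :
    ∫⁻ x, ‖f x‖ₑ ^ 2 ∂haarAddCircle = ∑' n, ‖fourierCoeff f n‖ₑ ^ 2 := by
  obtain ⟨g, hfg, hg⟩ := exists_Lp_ae_eq_of_summable hf hs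
  have hfL : MemLp f 2 haarAddCircle := (Lp.memLp g).ae_eq hfg.symm
  have h1 := tsum_sq_fourierCoeff g
  simp_rw [← fourierBasis_repr, hg] at h1
  have e (z : ℂ) : ‖z‖ₑ ^ 2 = ENNReal.ofReal (‖z‖ ^ 2) := by
    rw [ENNReal.ofReal_pow (norm_nonneg _), ofReal_norm]
  simp_rw [e]
  rw [← ENNReal.ofReal_tsum_of_nonneg (fun n => by positivity) hs, h1,
    ← ofReal_integral_eq_lintegral_ofReal ((memLp_two_iff_integrable_sq_norm hfL.1).1 hfL)
      (ae_of_all _ fun t => by positivity)]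
  congr 1
  refine integral_congr_ae ?_
  filter_upwards [hfg] with x hx
  rw [hx]

theorem integral_mul_conj_eq_tsum {f₁ f₂ : AddCircle L → ℂ} (hf₁ : Integrable f₁ haarAddCircle)
    (hf₂ : Integrable f₂ haarAddCircle) (hs₁ : Summable fun n => ‖fourierCoeff f₁ n‖ ^ 2)
    (hs₂ : Summable fun n => ‖fourierCoeff f₂ n‖ ^ 2) :
    ∫ x, f₁ x * conj (f₂ x) ∂haarAddCircle
      = ∑' n, fourierCoeff f₁ n * conj (fourierCoeff f₂ n) := by
  obtain ⟨g₁, hfg₁, hg₁⟩ := exists_Lp_ae_eq_of_summable hf₁ hs₁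
  obtain ⟨g₂, hfg₂, hg₂⟩ := exists_Lp_ae_eq_of_summable hf₂ hs₂
  have h := (fourierBasis (T := L)).repr.inner_map_map g₂ g₁
  rw [lp.inner_eq_tsum, L2.inner_def] at h
  simp_rw [hg₁, hg₂, RCLike.inner_apply] at h
  rw [h]
  refine integral_congr_ae ?_
  filter_upwards [hfg₁, hfg₂] with x h1 h2
  rw [h1, h2]

end Circle

/-! ### Plancherel in space-time -/

section SpaceTime

open AddCircle

variable {L : ℝ} [Fact (0 < L)] {u v : AddCircle L × ℝ → ℂ} {U V : ℤ → ℝ → ℂ}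

instance : SFinite (stMeasure L) := by
  unfold stMeasure
  infer_instance

theorem IsSpaceTimeFourier.integrable_fourier_mul (h : IsSpaceTimeFourier L u U) (n : ℤ)
    (φ : 𝓢(ℝ, ℂ)) : Integrable (fun p => fourier n p.1 * (u p * φ p.2)) (stMeasure L) := by
  refine (h.integrable_left φ).bdd_mul (c := 1) ?_ (ae_of_all _ fun p => ?_)
  · exact ((fourier n).continuous.comp continuous_fst).aestronglyMeasurable
  · simp [fourier_apply, Circle.norm_coe]

/-- The spatial Fourier coefficients of `u` have the time Fourier transforms `U n`. -/
theorem IsSpaceTimeFourier.isLineFourier (h : IsSpaceTimeFourier L u U) (n : ℤ) :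
    IsLineFourier (fun t => fourierCoeff (fun x => u (x, t)) n) (U n) := by
  have e (ψ : ℝ → ℂ) (t : ℝ) : fourierCoeff (fun x => u (x, t)) n * ψ t
      = ∫ x, fourier (-n) x * (u (x, t) * ψ t) ∂haarAddCircle := by
    unfold fourierCoeff
    rw [← integral_mul_const]
    simp_rw [smul_eq_mul, mul_assoc]
  constructor
  · intro φ
    have := (h.integrable_fourier_mul (-n) φ).integral_prod_right
    simpa only [e φ] using this
  · intro φ
    obtain ⟨ψ, hψ⟩ := exists_integral_exp_mul_schwartz φ
    rw [← h.integral_eq n φ]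
    simp_rw [hψ, e ψ]
    rw [stMeasure, ← integral_prod_symm _ (h.integrable_fourier_mul (-n) ψ)]
    congr! 2 with p
    ring

theorem IsSpaceTimeFourier.aestronglyMeasurable (h : IsSpaceTimeFourier L u U) :
    AEStronglyMeasurable u (stMeasure L) := by
  choose φ hφ using fun k : ℕ => exists_schwartz_eq_one k
  refine aestronglyMeasurable_of_tendsto_ae atTop (fun k => (h.integrable_left (φ k)).1)
    (ae_of_all _ fun p => ?_)
  refine tendsto_const_nhds.congr' ?_
  filter_upwards [eventually_ge_atTop ⌈|p.2|⌉₊] with k hk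
  rw [hφ k p.2 (Nat.ceil_le.1 hk), mul_one]

/-- Integrability is known only after multiplication by a Schwartz function of time. Countably many
of them, equal to 1 on growing intervals, give a common null set, and at each remaining time one of
them is 1. -/
theorem IsSpaceTimeFourier.ae_integrable (h : IsSpaceTimeFourier L u U) :
    ∀ᵐ t : ℝ, Integrable (fun x => u (x, t)) haarAddCircle := by
  choose φ hφ using fun k : ℕ => exists_schwartz_eq_one k
  have : ∀ᵐ t : ℝ, ∀ k, Integrable (fun x => u (x, t) * φ k t) haarAddCircle :=
    ae_all_iff.2 fun k => (h.integrable_left (φ k)).prod_left_ae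
  filter_upwards [this] with t ht
  refine (ht ⌈|t|⌉₊).congr (ae_of_all _ fun x => ?_)
  simp [hφ ⌈|t|⌉₊ t (Nat.le_ceil _)]

theorem IsSpaceTimeFourier.aestronglyMeasurable_right (h : IsSpaceTimeFourier L u U) (n : ℤ) :
    AEStronglyMeasurable (U n) volume :=
  (locallyIntegrable_of_integrable_mul_schwartz (h.integrable_right n)).aestronglyMeasurable

theorem memLp_two_of_seqNormL2 (hm : ∀ n, AEStronglyMeasurable (U n) volume)
    (hU : seqNormL2 (fun n τ => ‖U n τ‖ₑ) < ⊤) (n : ℤ) : MemLp (U n) 2 := by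
  refine ⟨hm n, ?_⟩
  rw [eLpNorm_lt_top_iff_lintegral_rpow_enorm_lt_top (by norm_num) (by norm_num)]
  have h1 : seqNormL2 (fun n τ => ‖U n τ‖ₑ) ^ 2 < ⊤ := ENNReal.pow_lt_top hU
  rw [seqNormL2_sq] at h1
  have h2 := (ENNReal.le_tsum n).trans_lt h1
  simpa using h2

theorem IsSpaceTimeFourier.tsum_lintegral_lt_top (h : IsSpaceTimeFourier L u U)
    (hU : seqNormL2 (fun n τ => ‖U n τ‖ₑ) < ⊤) :
    ∑' n, ∫⁻ t, ‖fourierCoeff (fun x => u (x, t)) n‖ₑ ^ 2 < ⊤ := by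
  have h1 : seqNormL2 (fun n τ => ‖U n τ‖ₑ) ^ 2 < ⊤ := ENNReal.pow_lt_top hU
  rw [seqNormL2_sq] at h1
  exact (ENNReal.tsum_le_tsum fun n => (h.isLineFourier n).lintegral_enorm_sq_le
    (memLp_two_of_seqNormL2 h.aestronglyMeasurable_right hU n)).trans_lt h1

theorem IsSpaceTimeFourier.aestronglyMeasurable_fourierCoeff (h : IsSpaceTimeFourier L u U)
    (n : ℤ) : AEStronglyMeasurable (fun t => fourierCoeff (fun x => u (x, t)) n) volume :=
  (locallyIntegrable_of_integrable_mul_schwartz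
    (h.isLineFourier n).integrable_left).aestronglyMeasurable

theorem IsSpaceTimeFourier.lintegral_tsum_eq (h : IsSpaceTimeFourier L u U) :
    ∫⁻ t, ∑' n, ‖fourierCoeff (fun x => u (x, t)) n‖ₑ ^ 2
      = ∑' n, ∫⁻ t, ‖fourierCoeff (fun x => u (x, t)) n‖ₑ ^ 2 :=
  lintegral_tsum fun n => (h.aestronglyMeasurable_fourierCoeff n).enorm.pow_const 2

theorem IsSpaceTimeFourier.ae_summable (h : IsSpaceTimeFourier L u U)
    (hU : seqNormL2 (fun n τ => ‖U n τ‖ₑ) < ⊤) :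
    ∀ᵐ t : ℝ, Summable fun n => ‖fourierCoeff (fun x => u (x, t)) n‖ ^ 2 := by
  have hfin := h.tsum_lintegral_lt_top hU
  rw [← h.lintegral_tsum_eq] at hfin
  have hm : AEMeasurable (fun t => ∑' n, ‖fourierCoeff (fun x => u (x, t)) n‖ₑ ^ 2) volume :=
    AEMeasurable.tsum fun n =>
      (h.aestronglyMeasurable_fourierCoeff n).enorm.pow_const 2
  filter_upwards [ae_lt_top' hm hfin.ne] with t ht
  have := ENNReal.summable_toReal ht.ne
  simpa using this

/-- A function with space-time Fourier transform in `l²L²` is square integrable. -/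
theorem IsSpaceTimeFourier.memLp (h : IsSpaceTimeFourier L u U)
    (hU : seqNormL2 (fun n τ => ‖U n τ‖ₑ) < ⊤) : MemLp u 2 (stMeasure L) := by
  refine ⟨h.aestronglyMeasurable, ?_⟩
  rw [eLpNorm_lt_top_iff_lintegral_rpow_enorm_lt_top (by norm_num) (by norm_num)]
  have hm : AEMeasurable (fun p => ‖u p‖ₑ ^ 2) (stMeasure L) :=
    h.aestronglyMeasurable.enorm.pow_const 2
  have : ∫⁻ p, ‖u p‖ₑ ^ 2 ∂stMeasure L < ⊤ := by
    rw [stMeasure, lintegral_prod_symm _ hm]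
    refine lt_of_eq_of_lt ?_ (h.tsum_lintegral_lt_top hU)
    rw [← h.lintegral_tsum_eq]
    refine lintegral_congr_ae ?_
    filter_upwards [h.ae_integrable, h.ae_summable hU] with t h1 h2
    exact lintegral_enorm_sq_eq_tsum h1 h2
  simpa using this

theorem IsSpaceTimeFourier.integrable_mul_conj (hu : IsSpaceTimeFourier L u U)
    (hv : IsSpaceTimeFourier L v V) (hU : seqNormL2 (fun n τ => ‖U n τ‖ₑ) < ⊤)
    (hV : seqNormL2 (fun n τ => ‖V n τ‖ₑ) < ⊤) :
    Integrable (fun p => u p * conj (v p)) (stMeasure L) :=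
  (hu.memLp hU).integrable_mul (hv.memLp hV).star

/-- The `L²` pairing of two functions is bounded by that of their Fourier transforms. -/
theorem IsSpaceTimeFourier.enorm_integral_mul_conj_le (hu : IsSpaceTimeFourier L u U)
    (hv : IsSpaceTimeFourier L v V) (hU : seqNormL2 (fun n τ => ‖U n τ‖ₑ) < ⊤)
    (hV : seqNormL2 (fun n τ => ‖V n τ‖ₑ) < ⊤) :
    ‖∫ p, u p * conj (v p) ∂stMeasure L‖ₑ ≤ ∑' n, ∫⁻ τ, ‖U n τ‖ₑ * ‖V n τ‖ₑ := by
  have hint := hu.integrable_mul_conj hv hU hV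
  have hm (n : ℤ) : AEStronglyMeasurable (fun t => fourierCoeff (fun x => u (x, t)) n *
      conj (fourierCoeff (fun x => v (x, t)) n)) volume :=
    (hu.aestronglyMeasurable_fourierCoeff n).mul (hv.aestronglyMeasurable_fourierCoeff n).star
  -- Absolute convergence, from `ab ≤ a² + b²`, justifies exchanging the sum over `n` and the time
  -- integral below.
  have hfin : ∑' n, ∫⁻ t, ‖fourierCoeff (fun x => u (x, t)) n *
      conj (fourierCoeff (fun x => v (x, t)) n)‖ₑ ≠ ⊤ := by
    refine ne_top_of_le_ne_top (ENNReal.add_lt_top.2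
      ⟨hu.tsum_lintegral_lt_top hU, hv.tsum_lintegral_lt_top hV⟩).ne ?_
    rw [← ENNReal.tsum_add]
    refine ENNReal.tsum_le_tsum fun n => ?_
    rw [← lintegral_add_left' ((hu.aestronglyMeasurable_fourierCoeff n).enorm.pow_const 2)]
    refine lintegral_mono fun t => ?_
    rw [enorm_mul, RCLike.enorm_conj]
    set a := ‖fourierCoeff (fun x => u (x, t)) n‖ₑ
    set b := ‖fourierCoeff (fun x => v (x, t)) n‖ₑ
    rcases le_total a b with hab | hab
    · calc a * b ≤ b * b := by gcongr
        _ ≤ a ^ 2 + b ^ 2 := by rw [← sq]; exact le_add_self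
    · calc a * b ≤ a * a := by gcongr
        _ ≤ a ^ 2 + b ^ 2 := by rw [← sq]; exact le_self_add
  -- Parseval in space at almost every time; Plancherel in time then acts on each coefficient.
  have heq : ∫ p, u p * conj (v p) ∂stMeasure L
      = ∑' n, ∫ t, fourierCoeff (fun x => u (x, t)) n *
        conj (fourierCoeff (fun x => v (x, t)) n) := by
    rw [stMeasure, integral_prod_symm _ hint, ← integral_tsum hm hfin]
    refine integral_congr_ae ?_
    filter_upwards [hu.ae_integrable, hu.ae_summable hU, hv.ae_integrable, hv.ae_summable hV]
      with t h1 h2 h3 h4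
    exact integral_mul_conj_eq_tsum h1 h3 h2 h4
  rw [heq]
  refine (enorm_tsum_le_tsum_enorm).trans (ENNReal.tsum_le_tsum fun n => ?_)
  exact (hu.isLineFourier n).enorm_integral_mul_conj_le (hv.isLineFourier n)
    (memLp_two_of_seqNormL2 hu.aestronglyMeasurable_right hU n)
    (memLp_two_of_seqNormL2 hv.aestronglyMeasurable_right hV n)

end SpaceTime

/-! ### Modulation, conjugation and products under the Fourier transform -/

section SpaceTimeOperations

set_option linter.unusedSectionVars false

open AddCircle

variable {L : ℝ} [Fact (0 < L)] {u v : AddCircle L × ℝ → ℂ} {U V : ℤ → ℝ → ℂ}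

theorem continuous_fourier_fst (n : ℤ) :
    Continuous fun p : AddCircle L × ℝ => (fourier n p.1 : ℂ) :=
  (fourier n).continuous.comp continuous_fst

theorem norm_fourier_eq_one (n : ℤ) (x : AddCircle L) : ‖(fourier n x : ℂ)‖ = 1 := by
  simp [fourier_apply, Circle.norm_coe]

theorem norm_exp_I_mul_mul (t τ : ℝ) : ‖Complex.exp (Complex.I * t * τ)‖ = 1 := by
  rw [show Complex.I * (t : ℂ) * (τ : ℂ) = ((t * τ : ℝ) : ℂ) * Complex.I by push_cast; ring]
  exact Complex.norm_exp_ofReal_mul_I _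

theorem norm_exp_neg_I_mul_mul (t τ : ℝ) : ‖Complex.exp (-(Complex.I * t * τ))‖ = 1 := by
  rw [Complex.exp_neg, norm_inv, norm_exp_I_mul_mul, inv_one]

/-- Modulation in space and time translates the Fourier transform. -/
theorem IsSpaceTimeFourier.modulate (h : IsSpaceTimeFourier L v V) (n : ℤ) (τ : ℝ) :
    IsSpaceTimeFourier L
      (fun p => v p * (fourier n p.1 * Complex.exp (Complex.I * (p.2 : ℂ) * (τ : ℂ))))
      (fun m s => V (m - n) (s - τ)) := by
  have hshift (φ : 𝓢(ℝ, ℂ)) (r : ℝ) : φ.compSubConstCLM ℂ (-τ) r = φ (r + τ) := by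
    rw [SchwartzMap.compSubConstCLM_apply, sub_neg_eq_add]
  refine ⟨fun φ => ?_, fun m φ => ?_, fun m φ => ?_⟩
  · have h2 : Continuous fun p : AddCircle L × ℝ =>
        Complex.exp (Complex.I * (p.2 : ℂ) * (τ : ℂ)) := by fun_prop
    have h3 := ((continuous_fourier_fst n).mul h2).aestronglyMeasurable (μ := stMeasure L)
    have h4 : ∀ p : AddCircle L × ℝ,
        ‖(fourier n p.1 : ℂ) * Complex.exp (Complex.I * (p.2 : ℂ) * (τ : ℂ))‖ ≤ 1 := fun p => by
      rw [norm_mul, norm_fourier_eq_one, norm_exp_I_mul_mul, one_mul]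
    have := (h.integrable_left φ).bdd_mul h3 (ae_of_all _ h4)
    refine this.congr (ae_of_all _ fun p => ?_)
    simp only [Pi.mul_apply]
    ring
  · have := (h.integrable_right (m - n) (φ.compSubConstCLM ℂ (-τ))).comp_sub_right τ
    refine this.congr (ae_of_all _ fun s => ?_)
    simp only
    rw [hshift, sub_add_cancel]
  · have key := h.integral_eq (m - n) (φ.compSubConstCLM ℂ (-τ))
    have hr : ∫ s, V (m - n) (s - τ) * φ s
        = ∫ r, V (m - n) r * φ.compSubConstCLM ℂ (-τ) r := by
      rw [← integral_sub_right_eq_self (fun r => V (m - n) r * φ.compSubConstCLM ℂ (-τ) r) τ]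
      simp_rw [hshift, sub_add_cancel]
    rw [hr, ← key]
    refine integral_congr_ae (ae_of_all _ fun p => ?_)
    have h1 : (fourier (-(m - n)) p.1 : ℂ) = fourier n p.1 * fourier (-m) p.1 := by
      rw [show -(m - n) = n + -m by ring, fourier_add]
    have h2 : ∫ r : ℝ, Complex.exp (-(Complex.I * (p.2 : ℂ) * (r : ℂ))) *
          φ.compSubConstCLM ℂ (-τ) r
        = Complex.exp (Complex.I * (p.2 : ℂ) * (τ : ℂ)) *
          ∫ r : ℝ, Complex.exp (-(Complex.I * (p.2 : ℂ) * (r : ℂ))) * φ r := by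
      rw [← integral_const_mul, ← integral_sub_right_eq_self
        (fun r : ℝ => Complex.exp (-(Complex.I * (p.2 : ℂ) * (r : ℂ))) *
          φ.compSubConstCLM ℂ (-τ) r) τ]
      congr! 2 with r
      rw [hshift, sub_add_cancel, ← mul_assoc, ← Complex.exp_add]
      congr 2
      push_cast
      ring
    simp only
    rw [h1, h2]
    ring

theorem exists_schwartz_conj (φ : 𝓢(ℝ, ℂ)) : ∃ ψ : 𝓢(ℝ, ℂ), ∀ t, ψ t = conj (φ t) := by
  refine ⟨SchwartzMap.postcompCLM (Complex.conjCLE : ℂ →L[ℝ] ℂ) φ, fun t => ?_⟩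
  rw [SchwartzMap.postcompCLM_apply]
  rfl

theorem integrable_conj {α : Type*} [MeasurableSpace α] {μ : Measure α} {f : α → ℂ}
    (hf : Integrable f μ) : Integrable (fun x => conj (f x)) μ :=
  memLp_one_iff_integrable.1 (memLp_one_iff_integrable.2 hf).star

/-- The Fourier transform of the complex conjugate. -/
theorem IsSpaceTimeFourier.conj (h : IsSpaceTimeFourier L v V) :
    IsSpaceTimeFourier L (fun p => conj (v p)) (fun n τ => conj (V (-n) (-τ))) := by
  refine ⟨fun φ => ?_, fun n φ => ?_, fun n φ => ?_⟩
  · obtain ⟨ψ, hψ⟩ := exists_schwartz_conj φ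
    refine (integrable_conj (h.integrable_left ψ)).congr (ae_of_all _ fun p => ?_)
    simp [hψ]
  · obtain ⟨ψ, hψ⟩ := exists_schwartz_conj φ
    obtain ⟨χ, hχ⟩ := exists_schwartz_dilation ψ (show (-1 : ℝ) ≠ 0 by norm_num)
    have := integrable_conj (h.integrable_right (-n) χ).comp_neg
    refine this.congr (ae_of_all _ fun s => ?_)
    simp [hψ, hχ]
  · obtain ⟨ψ, hψ⟩ := exists_schwartz_conj φ
    obtain ⟨χ, hχ⟩ := exists_schwartz_dilation ψ (show (-1 : ℝ) ≠ 0 by norm_num)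
    have key := congrArg (starRingEnd ℂ) (h.integral_eq (-n) χ)
    rw [← integral_conj, ← integral_conj] at key
    have h1 : ∫ τ, conj (V (-n) (-τ)) * φ τ = ∫ τ, conj (V (-n) τ * χ τ) := by
      rw [← integral_neg_eq_self]
      congr! 2 with τ
      simp [hχ, hψ]
    rw [h1, ← key]
    refine integral_congr_ae (ae_of_all _ fun p => ?_)
    simp only
    rw [map_mul, map_mul, ← fourier_neg, ← integral_conj, neg_neg (-n)]
    congr 1
    rw [← integral_neg_eq_self]
    congr! 2 with τ
    rw [map_mul, ← Complex.exp_conj, hχ, hψ]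
    simp

theorem IsSpaceTimeFourier.add (hu : IsSpaceTimeFourier L u U) (hv : IsSpaceTimeFourier L v V) :
    IsSpaceTimeFourier L (u + v) (U + V) := by
  refine ⟨fun φ => ?_, fun n φ => ?_, fun n φ => ?_⟩
  · simp_rw [Pi.add_apply, add_mul]
    exact (hu.integrable_left φ).add (hv.integrable_left φ)
  · simp_rw [Pi.add_apply, add_mul]
    exact (hu.integrable_right n φ).add (hv.integrable_right n φ)
  · simp_rw [Pi.add_apply, add_mul]
    obtain ⟨ψ, hψ⟩ := exists_integral_exp_mul_schwartz φ
    have h1 := hu.integral_eq n φ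
    have h2 := hv.integral_eq n φ
    simp_rw [hψ] at h1 h2 ⊢
    rw [integral_add (hu.integrable_right n φ) (hv.integrable_right n φ), ← h1, ← h2,
      ← integral_add]
    · refine (hu.integrable_fourier_mul (-n) ψ).congr (ae_of_all _ fun p => ?_)
      simp only
      ring
    · refine (hv.integrable_fourier_mul (-n) ψ).congr (ae_of_all _ fun p => ?_)
      simp only
      ring

/-- The space-time Fourier transform of an integrable function is given by the integral. -/
theorem isSpaceTimeFourier_of_integrable (hu : Integrable u (stMeasure L)) :
    IsSpaceTimeFourier L u (fun n τ => ∫ p, u p * (fourier (-n) p.1 *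
      Complex.exp (-(Complex.I * (p.2 : ℂ) * (τ : ℂ)))) ∂stMeasure L) := by
  have hint (n : ℤ) (φ : 𝓢(ℝ, ℂ)) : Integrable (fun q : (AddCircle L × ℝ) × ℝ =>
      u q.1 * (fourier (-n) q.1.1 * Complex.exp (-(Complex.I * (q.1.2 : ℂ) * (q.2 : ℂ)))) * φ q.2)
      ((stMeasure L).prod volume) := by
    have h2 : Continuous fun q : (AddCircle L × ℝ) × ℝ =>
        Complex.exp (-(Complex.I * (q.1.2 : ℂ) * (q.2 : ℂ))) := by fun_prop
    have h3 := (((continuous_fourier_fst (-n)).comp continuous_fst).mul h2).aestronglyMeasurable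
      (μ := (stMeasure L).prod volume)
    have h4 : ∀ q : (AddCircle L × ℝ) × ℝ, ‖(fourier (-n) q.1.1 : ℂ) *
        Complex.exp (-(Complex.I * (q.1.2 : ℂ) * (q.2 : ℂ)))‖ ≤ 1 := fun q => by
      rw [norm_mul, norm_fourier_eq_one, norm_exp_neg_I_mul_mul, one_mul]
    have := (hu.mul_prod (φ.integrable (μ := volume))).bdd_mul h3 (ae_of_all _ h4)
    refine this.congr (ae_of_all _ fun q => ?_)
    simp only [Pi.mul_apply, Function.comp_apply]
    ring
  refine ⟨fun φ => ?_, fun n φ => ?_, fun n φ => ?_⟩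
  · have hb : ∃ C, ∀ t, ‖φ t‖ ≤ C :=
      ⟨‖φ.toBoundedContinuousFunction‖, φ.toBoundedContinuousFunction.norm_coe_le_norm⟩
    obtain ⟨C, hC⟩ := hb
    exact hu.mul_bdd (c := C) (φ.continuous.comp continuous_snd).aestronglyMeasurable
      (ae_of_all _ fun p => hC p.2)
  · have := (hint n φ).integral_prod_right
    simpa only [integral_mul_const] using this
  · have h1 := integral_integral_swap (f := fun (p : AddCircle L × ℝ) (τ : ℝ) =>
      u p * (fourier (-n) p.1 * Complex.exp (-(Complex.I * (p.2 : ℂ) * (τ : ℂ)))) * φ τ)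
      (hint n φ)
    simp_rw [integral_mul_const] at h1
    rw [← h1]
    refine integral_congr_ae (ae_of_all _ fun p => ?_)
    simp only
    rw [← integral_const_mul]
    congr! 2 with τ
    ring

/-- The Fourier transform of `u * conj v` is a function bounded by the correlation of the
Fourier transforms of `u` and `v`. -/
theorem IsSpaceTimeFourier.exists_mul_conj (hu : IsSpaceTimeFourier L u U)
    (hv : IsSpaceTimeFourier L v V) (hU : seqNormL2 (fun n τ => ‖U n τ‖ₑ) < ⊤)
    (hV : seqNormL2 (fun n τ => ‖V n τ‖ₑ) < ⊤) :
    ∃ W : ℤ → ℝ → ℂ, IsSpaceTimeFourier L (fun p => u p * conj (v p)) W ∧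
      ∀ n τ, ‖W n τ‖ₑ ≤ seqCorr (fun m s => ‖U m s‖ₑ) (fun m s => ‖V m s‖ₑ) n τ := by
  -- The integral formula for the transform at `(n, τ)` is the L² pairing of `u` with `v` modulated
  -- by `(n, τ)`, so the bound holds at every point.
  refine ⟨_, isSpaceTimeFourier_of_integrable (hu.integrable_mul_conj hv hU hV), fun n τ => ?_⟩
  have hV' : seqNormL2 (fun m s => ‖V (m - n) (s - τ)‖ₑ) < ⊤ := by
    have : seqNormL2 (fun m s => ‖V (m - n) (s - τ)‖ₑ) = seqNormL2 (fun m s => ‖V m s‖ₑ) := by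
      unfold seqNormL2
      have h1 (m : ℤ) : normL2 volume (fun s => ‖V (m - n) (s - τ)‖ₑ)
          = normL2 volume (fun s => ‖V (m - n) s‖ₑ) :=
        normL2_comp_sub_right volume (fun s => ‖V (m - n) s‖ₑ) τ
      simp_rw [h1]
      exact normL2_comp_sub_right Measure.count (fun m => normL2 volume fun s => ‖V m s‖ₑ) n
    rwa [this]
  refine le_trans (le_of_eq ?_) (hu.enorm_integral_mul_conj_le (hv.modulate n τ) hU hV')
  congr 2 with p
  rw [map_mul, map_mul, ← fourier_neg, ← Complex.exp_conj]
  simp only [map_mul, Complex.conj_I, Complex.conj_ofReal]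
  ring_nf

end SpaceTimeOperations

/-! ### Bilinear estimates for the weighted norms and their completions -/

section WeightedNorm

set_option linter.unusedSectionVars false

open AddCircle

variable {L : ℝ} [Fact (0 < L)] {u v : AddCircle L × ℝ → ℂ} {U V : ℤ → ℝ → ℂ}

theorem l2L2Norm_eq (U : ℤ → ℝ → ℂ) : l2L2Norm U = seqNormL2 (fun n τ => ‖U n τ‖ₑ) := by
  rw [l2L2Norm, seqNormL2_eq]
  congr 2 with n
  rw [eLpNorm_eq_lintegral_rpow_enorm_toReal (by norm_num) (by norm_num),
    ← ENNReal.rpow_natCast, ← ENNReal.rpow_mul]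
  norm_num

theorem normL2_add_le {G : Type*} [MeasurableSpace G] {μ : Measure G} {f g : G → ℝ≥0∞}
    (hf : AEMeasurable f μ) (hg : AEMeasurable g μ) :
    normL2 μ (fun x => f x + g x) ≤ normL2 μ f + normL2 μ g := by
  have := ENNReal.lintegral_Lp_add_le hf hg (p := 2) (by norm_num)
  simpa [normL2] using this

theorem seqNormL2_add_le {f g : ℤ → ℝ → ℝ≥0∞} (hf : ∀ n, AEMeasurable (f n))
    (hg : ∀ n, AEMeasurable (g n)) :
    seqNormL2 (fun n τ => f n τ + g n τ) ≤ seqNormL2 f + seqNormL2 g :=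
  (normL2_mono fun n => normL2_add_le (hf n) (hg n)).trans
    (normL2_add_le Measurable.of_discrete.aemeasurable Measurable.of_discrete.aemeasurable)

theorem weightedNorm_add_le {w : ℤ → ℝ → ℝ} (hw : ∀ n, Measurable (w n)) :
    weightedNorm L w (u + v) ≤ weightedNorm L w u + weightedNorm L w v := by
  unfold weightedNorm
  rw [ENNReal.iInf₂_add]
  refine le_iInf₂ fun U hU => ?_
  rw [ENNReal.add_iInf₂]
  refine le_iInf₂ fun V hV => (iInf₂_le _ (hU.add hV)).trans ?_
  simp_rw [l2L2Norm_eq]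
  have hm {u : AddCircle L × ℝ → ℂ} {U : ℤ → ℝ → ℂ} (hU : IsSpaceTimeFourier L u U) (n : ℤ) :
      AEMeasurable (fun τ => ‖(w n τ : ℂ) * U n τ‖ₑ) volume :=
    ((Complex.measurable_ofReal.comp (hw n)).aestronglyMeasurable.mul
      (hU.aestronglyMeasurable_right n)).enorm
  refine le_trans (seqNormL2_mono fun n τ => ?_) (seqNormL2_add_le (hm hU) (hm hV))
  rw [Pi.add_apply, Pi.add_apply, mul_add]
  exact enorm_add_le _ _

theorem IsSpaceTimeFourier.exists_measurable (h : IsSpaceTimeFourier L u U) :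
    ∃ U' : ℤ → ℝ → ℂ, (∀ n, Measurable (U' n)) ∧ (∀ n, U n =ᵐ[volume] U' n) ∧
      IsSpaceTimeFourier L u U' := by
  refine ⟨fun n => (h.aestronglyMeasurable_right n).mk (U n),
    fun n => (h.aestronglyMeasurable_right n).stronglyMeasurable_mk.measurable,
    fun n => (h.aestronglyMeasurable_right n).ae_eq_mk, h.integrable_left, fun n φ => ?_,
    fun n φ => ?_⟩
  · refine (h.integrable_right n φ).congr ?_
    filter_upwards [(h.aestronglyMeasurable_right n).ae_eq_mk] with τ hτ
    rw [hτ]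
  · rw [h.integral_eq n φ]
    refine integral_congr_ae ?_
    filter_upwards [(h.aestronglyMeasurable_right n).ae_eq_mk] with τ hτ
    rw [hτ]

theorem l2L2Norm_congr_ae (h : ∀ n, U n =ᵐ[volume] V n) : l2L2Norm U = l2L2Norm V := by
  unfold l2L2Norm
  congr 2 with n
  rw [eLpNorm_congr_ae (h n)]

/-- A function of small weighted norm has a measurable Fourier transform of small weighted norm. -/
theorem exists_measurable_lt_of_weightedNorm_lt {w : ℤ → ℝ → ℝ} {r : ℝ≥0∞}
    (h : weightedNorm L w u < r) :
    ∃ U : ℤ → ℝ → ℂ, (∀ n, Measurable (U n)) ∧ IsSpaceTimeFourier L u U ∧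
      l2L2Norm (fun n τ => (w n τ : ℂ) * U n τ) < r := by
  unfold weightedNorm at h
  simp_rw [iInf_lt_iff] at h
  obtain ⟨U, hU, hlt⟩ := h
  obtain ⟨U', hm, hae, hU'⟩ := hU.exists_measurable
  refine ⟨U', hm, hU', ?_⟩
  rwa [← l2L2Norm_congr_ae (U := fun n τ => (w n τ : ℂ) * U n τ)]
  intro n
  filter_upwards [hae n] with τ hτ
  rw [hτ]

theorem seqNormL2_neg (f : ℤ → ℝ → ℝ≥0∞) :
    seqNormL2 (fun n τ => f (-n) (-τ)) = seqNormL2 f := by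
  have h1 (n : ℤ) : normL2 volume (fun τ => f n (-τ)) = normL2 volume (f n) := by
    simpa using normL2_comp_sub_left volume (f n) 0
  unfold seqNormL2
  simp_rw [h1]
  simpa using normL2_comp_sub_left Measure.count (fun n => normL2 volume (f n)) (0 : ℤ)

theorem weightedNorm_conj_le {w : ℤ → ℝ → ℝ} (hw : ∀ n τ, w (-n) (-τ) = w n τ) :
    weightedNorm L w (fun p => conj (v p)) ≤ weightedNorm L w v := by
  refine le_iInf₂ fun V hV => (iInf₂_le _ hV.conj).trans_eq ?_
  rw [l2L2Norm_eq, l2L2Norm_eq, ← seqNormL2_neg fun n τ => ‖(w n τ : ℂ) * V n τ‖ₑ]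
  congr 1
  ext n τ
  rw [enorm_mul, enorm_mul, hw, RCLike.enorm_conj]

/-- A weighted correlation estimate on the Fourier side gives a bilinear estimate in physical
space. -/
theorem weightedNorm_mul_conj_le {ρ₀ ρ₁ ρ₂ : ℤ → ℝ → ℝ} (hρ₁ : ∀ n, Measurable (ρ₁ n))
    (hρ₂ : ∀ n, Measurable (ρ₂ n)) {e₀ e₁ e₂ : ℝ} (he₁ : 0 ≤ e₁) (he₂ : 0 ≤ e₂) {C : ℝ≥0∞}
    (hC₀ : C ≠ 0) (hC : C ≠ ⊤)
    (h : ∀ f g : ℤ → ℝ → ℝ≥0∞, (∀ n, Measurable (f n)) → (∀ n, Measurable (g n)) →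
      seqNormL2 (fun n τ => ENNReal.ofReal (bracket (ρ₀ n τ) ^ (-e₀)) * seqCorr
        (fun m s => ENNReal.ofReal (bracket (ρ₁ m s) ^ (-e₁)) * f m s)
        (fun m s => ENNReal.ofReal (bracket (ρ₂ m s) ^ (-e₂)) * g m s) n τ)
        ≤ C * (seqNormL2 f * seqNormL2 g))
    (hu : weightedNorm L (fun n τ => bracket (ρ₁ n τ) ^ e₁) u < ⊤)
    (hv : weightedNorm L (fun n τ => bracket (ρ₂ n τ) ^ e₂) v < ⊤) :
    weightedNorm L (fun n τ => bracket (ρ₀ n τ) ^ (-e₀)) (fun p => u p * conj (v p))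
      ≤ C * weightedNorm L (fun n τ => bracket (ρ₁ n τ) ^ e₁) u
        * weightedNorm L (fun n τ => bracket (ρ₂ n τ) ^ e₂) v := by
  have hen (x e : ℝ) : ‖((bracket x ^ e : ℝ) : ℂ)‖ₑ = ENNReal.ofReal (bracket x ^ e) := by
    rw [← ofReal_norm, Complex.norm_real, Real.norm_of_nonneg (Real.rpow_nonneg (bracket_pos x).le e)]
  have hcancel (x e : ℝ) (z : ℂ) :
      ENNReal.ofReal (bracket x ^ (-e)) * ‖((bracket x ^ e : ℝ) : ℂ) * z‖ₑ = ‖z‖ₑ := by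
    rw [enorm_mul, hen, ← mul_assoc, ← ENNReal.ofReal_mul (Real.rpow_nonneg (bracket_pos x).le _),
      ← Real.rpow_add (bracket_pos x), neg_add_cancel, Real.rpow_zero, ENNReal.ofReal_one, one_mul]
  have hle {x e : ℝ} (he : 0 ≤ e) (z : ℂ) : ‖z‖ₑ ≤ ‖((bracket x ^ e : ℝ) : ℂ) * z‖ₑ := by
    rw [enorm_mul, hen]
    refine le_mul_of_one_le_left' ?_
    rw [ENNReal.one_le_ofReal]
    exact Real.one_le_rpow (one_le_bracket x) he
  have hmeas {ρ : ℤ → ℝ → ℝ} (hρ : ∀ n, Measurable (ρ n)) (e : ℝ) {U : ℤ → ℝ → ℂ}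
      (hU : ∀ n, Measurable (U n)) (n : ℤ) :
      Measurable fun τ => ‖((bracket (ρ n τ) ^ e : ℝ) : ℂ) * U n τ‖ₑ :=
    ((Complex.measurable_ofReal.comp ((measurable_bracket.comp (hρ n)).pow_const e)).mul
      (hU n)).enorm
  -- The norms are infima, so the estimate is proved with any strictly larger bounds, which are then
  -- let decrease to the norms.
  have key : ∀ a' > weightedNorm L (fun n τ => bracket (ρ₁ n τ) ^ e₁) u,
      ∀ b' > weightedNorm L (fun n τ => bracket (ρ₂ n τ) ^ e₂) v,
      weightedNorm L (fun n τ => bracket (ρ₀ n τ) ^ (-e₀)) (fun p => u p * conj (v p))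
        ≤ C * (a' * b') := by
    intro a' ha' b' hb'
    obtain ⟨U, hUm, hU, hUlt⟩ := exists_measurable_lt_of_weightedNorm_lt ha'
    obtain ⟨V, hVm, hV, hVlt⟩ := exists_measurable_lt_of_weightedNorm_lt hb'
    rw [l2L2Norm_eq] at hUlt hVlt
    have hUfin : seqNormL2 (fun n τ => ‖U n τ‖ₑ) < ⊤ :=
      (seqNormL2_mono fun n τ => hle he₁ _).trans_lt (hUlt.trans_le le_top)
    have hVfin : seqNormL2 (fun n τ => ‖V n τ‖ₑ) < ⊤ :=
      (seqNormL2_mono fun n τ => hle he₂ _).trans_lt (hVlt.trans_le le_top)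
    obtain ⟨W, hW, hWle⟩ := hU.exists_mul_conj hV hUfin hVfin
    refine (iInf₂_le W hW).trans ?_
    -- With the weighted transforms as `f` and `g`, the negative powers in the hypothesis cancel the
    -- weights and leave the correlation of `‖U‖` and `‖V‖`.
    have hest := h _ _ (hmeas hρ₁ e₁ hUm) (hmeas hρ₂ e₂ hVm)
    simp_rw [hcancel] at hest
    rw [l2L2Norm_eq]
    refine le_trans (seqNormL2_mono fun n τ => ?_) (hest.trans ?_)
    · rw [enorm_mul, hen]
      gcongr
      exact hWle n τ
    · gcongr
  rw [mul_assoc, ← ENNReal.div_le_iff' hC₀ hC]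
  exact ENNReal.le_mul_of_forall_lt (.inr hv.ne) (.inl hu.ne) fun a' ha' b' hb' =>
    ENNReal.div_le_of_le_mul' (key a' ha' b' hb')

/-- A bounded bilinear operation which preserves the test class maps completions to
completions. -/
theorem MemCompletion.map₂ {w₀ w₁ w₂ : ℤ → ℝ → ℝ} (hw₀ : ∀ n, Measurable (w₀ n))
    (hw₂ : ∀ n, Measurable (w₂ n))
    {op : (AddCircle L × ℝ → ℂ) → (AddCircle L × ℝ → ℂ) → AddCircle L × ℝ → ℂ}
    (hleft : ∀ f f' g, op (f - f') g = op f g - op f' g)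
    (hright : ∀ f g g', op f (g - g') = op f g - op f g')
    (htest : ∀ f ∈ testClass L, ∀ g ∈ testClass L, op f g ∈ testClass L) {C : ℝ≥0∞} (hC : C ≠ ⊤)
    (hop : ∀ f g, weightedNorm L w₁ f < ⊤ → weightedNorm L w₂ g < ⊤ →
      weightedNorm L w₀ (op f g) ≤ C * weightedNorm L w₁ f * weightedNorm L w₂ g)
    (hu : MemCompletion L w₁ u) (hv : MemCompletion L w₂ v) :
    MemCompletion L w₀ (op u v) := by
  obtain ⟨hufin, F, hF, hFlim⟩ := hu
  obtain ⟨hvfin, G, hG, hGlim⟩ := hv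
  refine ⟨(hop u v hufin hvfin).trans_lt (by finiteness), fun k => op (F k) (G k),
    fun k => htest _ (hF k) _ (hG k), ?_⟩
  set a := weightedNorm L w₁ u
  set b := weightedNorm L w₂ v
  set x := fun k => weightedNorm L w₁ (F k - u)
  set y := fun k => weightedNorm L w₂ (G k - v)
  have hlim : Tendsto (fun k => C * x k * (y k + b) + C * a * y k) atTop (𝓝 0) := by
    have h1 : Tendsto (fun k => C * x k * (y k + b)) atTop (𝓝 (C * 0 * (0 + b))) := by
      refine ENNReal.Tendsto.mul (ENNReal.Tendsto.const_mul hFlim (.inr hC)) (.inr ?_)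
        (hGlim.add tendsto_const_nhds) (.inr ?_)
      · finiteness
      · finiteness
    have h2 : Tendsto (fun k => C * a * y k) atTop (𝓝 (C * a * 0)) :=
      ENNReal.Tendsto.const_mul hGlim (.inr (by finiteness))
    simpa using h1.add h2
  refine tendsto_of_tendsto_of_tendsto_of_le_of_le' tendsto_const_nhds hlim
    (Eventually.of_forall fun k => zero_le) ?_
  -- `hop` applies only to functions of finite norm, which the differences have for large `k`.
  filter_upwards [hFlim.eventually_lt_const (u := ⊤) (by simp),
    hGlim.eventually_lt_const (u := ⊤) (by simp)] with k hx hy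
  have hGk : weightedNorm L w₂ (G k) ≤ y k + b := by
    have := weightedNorm_add_le (L := L) (u := G k - v) (v := v) hw₂
    rwa [sub_add_cancel] at this
  -- The usual telescoping for continuity of a bilinear map; the two terms give the two summands of
  -- the majorant in `hlim`.
  have hsplit : op (F k) (G k) - op u v = op (F k - u) (G k) + op u (G k - v) := by
    rw [hleft, hright]
    abel
  rw [hsplit]
  refine (weightedNorm_add_le hw₀).trans ?_
  have hGfin : weightedNorm L w₂ (G k) < ⊤ := hGk.trans_lt (ENNReal.add_lt_top.2 ⟨hy, hvfin⟩)
  refine add_le_add ((hop _ _ hx hGfin).trans ?_) (hop _ _ hufin hy)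
  gcongr

theorem mul_mem_testClass {F G : AddCircle L × ℝ → ℂ} (hF : F ∈ testClass L)
    (hG : G ∈ testClass L) : (fun p => F p * G p) ∈ testClass L := by
  refine ⟨fun x => ?_, fun t => (hF.2 t).mul (hG.2 t)⟩
  obtain ⟨f, hf⟩ := hF.1 x
  obtain ⟨g, hg⟩ := hG.1 x
  refine ⟨SchwartzMap.pairing (ContinuousLinearMap.mul ℂ ℂ) f g, fun t => ?_⟩
  rw [SchwartzMap.pairing_apply_apply, ContinuousLinearMap.mul_apply', ← hf, ← hg]

theorem conj_mem_testClass {F : AddCircle L × ℝ → ℂ} (hF : F ∈ testClass L) :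
    (fun p => conj (F p)) ∈ testClass L := by
  refine ⟨fun x => ?_, fun t => Complex.conjCLE.contDiff.comp (hF.2 t)⟩
  obtain ⟨f, hf⟩ := hF.1 x
  obtain ⟨g, hg⟩ := exists_schwartz_conj f
  exact ⟨g, fun t => by rw [hg, ← hf]⟩

end WeightedNorm

/-! ### The weights at `s = 0` and the theorem -/

theorem weightS_zero (L b : ℝ) : weightS L 0 b = fun n τ => bracket (modS L n τ) ^ b := by
  ext n τ
  rw [weightS, Real.rpow_zero, mul_one, modS]

theorem weightB_zero (L b : ℝ) : weightB L 0 b = fun n τ => bracket (modB L n τ) ^ b := by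
  ext n τ
  rw [weightB, Real.rpow_zero, mul_one, modB]

/-- This symmetry, which the Schrödinger modulation lacks, is what allows `v` to be replaced by its
conjugate in part (i). -/
theorem modB_neg (L : ℝ) (n : ℤ) (τ : ℝ) : modB L (-n) (-τ) = modB L n τ := by
  rw [modB, modB, gammaL, gammaL, abs_neg, Int.cast_neg, neg_sq,
    show (-(n : ℝ)) ^ 4 = (n : ℝ) ^ 4 by ring]

theorem measurable_weightS (L b : ℝ) (n : ℤ) : Measurable (weightS L 0 b n) := by
  rw [weightS_zero]
  exact (measurable_bracket.comp (measurable_modS L n)).pow_const b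

theorem measurable_weightB (L b : ℝ) (n : ℤ) : Measurable (weightB L 0 b n) := by
  rw [weightB_zero]
  exact (measurable_bracket.comp (measurable_modB L n)).pow_const b

end SB

theorem theorem1p4 (L : ℝ) [Fact (0 < L)] (a a₁ b b₁ : ℝ)
    (ha : 1 / 4 < a) (ha₁ : 1 / 4 < a₁) (hb : 1 / 4 < b) (hb₁ : 1 / 4 < b₁) :
    ∃ c : ℝ, 0 < c ∧
      (∀ u v : AddCircle L × ℝ → ℂ, SB.MemXS L 0 b₁ u → SB.MemXB L 0 b v →
        SB.MemXS L 0 (-a₁) (fun p => u p * v p) ∧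
        SB.normXS L 0 (-a₁) (fun p => u p * v p)
          ≤ ENNReal.ofReal c * SB.normXS L 0 b₁ u * SB.normXB L 0 b v) ∧
      (∀ u₁ u₂ : AddCircle L × ℝ → ℂ, SB.MemXS L 0 b₁ u₁ → SB.MemXS L 0 b₁ u₂ →
        SB.MemXB L 0 (-a) (fun p => u₁ p * conj (u₂ p)) ∧
        SB.normXB L 0 (-a) (fun p => u₁ p * conj (u₂ p))
          ≤ ENNReal.ofReal c * SB.normXS L 0 b₁ u₁ * SB.normXS L 0 b₁ u₂) := by
  -- One exponent above 1/4 and below all four, so that a single constant serves both parts.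
  set d := min (min a a₁) (min b b₁)
  have hd : 1 / 4 < d := lt_min (lt_min ha ha₁) (lt_min hb hb₁)
  have hda : d ≤ a := (min_le_left _ _).trans (min_le_left _ _)
  have hda₁ : d ≤ a₁ := (min_le_left _ _).trans (min_le_right _ _)
  have hdb : d ≤ b := (min_le_right _ _).trans (min_le_left _ _)
  have hdb₁ : d ≤ b₁ := (min_le_right _ _).trans (min_le_right _ _)
  obtain ⟨C, hC, hest⟩ := SB.exists_weighted_corr_le (L := L) Fact.out hd
  -- `C + 1` replaces `C` because the constant must be nonzero, both for the division in
  -- `weightedNorm_mul_conj_le` and for `0 < c`.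
  have hC1 : C + 1 ≠ ⊤ := ENNReal.add_ne_top.2 ⟨hC, ENNReal.one_ne_top⟩
  have hC0 : C + 1 ≠ 0 := by simp
  have hS (u v : AddCircle L × ℝ → ℂ) (hu : SB.weightedNorm L (SB.weightS L 0 b₁) u < ⊤)
      (hv : SB.weightedNorm L (SB.weightB L 0 b) v < ⊤) :
      SB.weightedNorm L (SB.weightS L 0 (-a₁)) (fun p => u p * v p)
        ≤ (C + 1) * SB.weightedNorm L (SB.weightS L 0 b₁) u
          * SB.weightedNorm L (SB.weightB L 0 b) v := by
    rw [SB.weightS_zero, SB.weightS_zero, SB.weightB_zero] at *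
    have hconj : SB.weightedNorm L (fun n τ => SB.bracket (SB.modB L n τ) ^ b)
        (fun p => conj (v p)) ≤ SB.weightedNorm L (fun n τ => SB.bracket (SB.modB L n τ) ^ b) v :=
      SB.weightedNorm_conj_le fun n τ => by rw [SB.modB_neg]
    -- The product `u v` is treated as `u` times the conjugate of `conj v`.
    have key := SB.weightedNorm_mul_conj_le (L := L) (u := u) (v := fun p => conj (v p))
      (ρ₀ := SB.modS L) (e₀ := a₁) (e₁ := b₁) (e₂ := b)
      (SB.measurable_modS L) (SB.measurable_modB L) (by linarith) (by linarith) hC0 hC1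
      (fun f g hf hg => ((hest a₁ b₁ b hda₁ hdb₁ hdb f g hf hg).1).trans (by gcongr; simp))
      hu (hconj.trans_lt hv)
    simp only [Complex.conj_conj] at key
    exact key.trans (by gcongr)
  have hB (u v : AddCircle L × ℝ → ℂ) (hu : SB.weightedNorm L (SB.weightS L 0 b₁) u < ⊤)
      (hv : SB.weightedNorm L (SB.weightS L 0 b₁) v < ⊤) :
      SB.weightedNorm L (SB.weightB L 0 (-a)) (fun p => u p * conj (v p))
        ≤ (C + 1) * SB.weightedNorm L (SB.weightS L 0 b₁) u
          * SB.weightedNorm L (SB.weightS L 0 b₁) v := by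
    rw [SB.weightS_zero, SB.weightB_zero] at *
    exact SB.weightedNorm_mul_conj_le (SB.measurable_modS L) (SB.measurable_modS L) (by linarith)
      (by linarith) hC0 hC1
      (fun f g hf hg => ((hest a b₁ b₁ hda hdb₁ hdb₁ f g hf hg).2).trans (by gcongr; simp)) hu hv
  refine ⟨(C + 1).toReal, ENNReal.toReal_pos hC0 hC1, fun u v hu hv => ⟨?_, ?_⟩,
    fun u₁ u₂ hu₁ hu₂ => ⟨?_, ?_⟩⟩
  · exact SB.MemCompletion.map₂ (op := fun f g p => f p * g p) (SB.measurable_weightS L _)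
      (SB.measurable_weightB L _)
      (fun f f' g => by ext p; exact sub_mul _ _ _) (fun f g g' => by ext p; exact mul_sub _ _ _)
      (fun f hf g hg => SB.mul_mem_testClass hf hg) hC1 hS hu hv
  · rw [ENNReal.ofReal_toReal hC1]
    exact hS u v hu.1 hv.1
  · exact SB.MemCompletion.map₂ (op := fun f g p => f p * conj (g p)) (SB.measurable_weightB L _)
      (SB.measurable_weightS L _)
      (fun f f' g => by ext p; exact sub_mul _ _ _)
      (fun f g g' => by ext p; simp [mul_sub])
      (fun f hf g hg => SB.mul_mem_testClass hf (SB.conj_mem_testClass hg)) hC1 hB hu₁ hu₂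
  · rw [ENNReal.ofReal_toReal hC1]
    exact hB u₁ u₂ hu₁.1 hu₂.1
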